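/- Let $0\le a<b<\infty$ and let $\varphi=(\varphi_1,\varphi_2)$ be a pair of real functions on $[a,b]$ satisfying condition (C1): $\varphi_1,\varphi_2\in C^1[a,b]$ (hence they are Lipschitz), both are increasing, $\varphi_1+\varphi_2$ is strictly increasing, and $\varphi_1'(x)+\varphi_2'(x)>0$ for all $x\in[a,b]\setminus\{0\}$. For an $n\times n$ complex matrix $X$ put $|X|=(X^*X)^{1/2}$, let $M_n[a,b]$ be the set of $n\times n$ complex matrices $X$ for which the spectrum of $|X|$ is contained in $[a,b]$, and for $X\in M_n[a,b]$ put $\varphi(X)=\varphi_1(|X|)-\varphi_2(|X^*|)$ (functional calculus). Let $T\in M_n[a,b]$ be diagonalizable. Then the initial value problem \[\frac{dX(t)}{dt}=[\varphi(X(t)),X(t)],\qquad X(0)=T,\] has a unique global solution $X(t)=F^\varphi_t(T)$ on $[0,\infty)$ with values in $M_n[a,b]$, and it converges exponentially fast to a normal matrix in the similarity orbit of $T$: there are a normal matrix $N=PTP^{-1}$ with $P\in GL(n,\mathbb{C})$ and constants $C,c>0$ such that $\|X(t)-N\|\le Ce^{-ct}$ for all $t\ge 0$, where $\|\cdot\|$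 is the operator norm. -/

import Mathlib

open scoped Matrix

noncomputable section

namespace MatrixFlow

/-- Condition (C0) on a pair of functions on `[a, b]`: both are continuous and increasing,
and their sum is strictly increasing. -/
structure CondC0 (φ₁ φ₂ : ℝ → ℝ) (a b : ℝ) : Prop where
  continuousOn₁ : ContinuousOn φ₁ (Set.Icc a b)
  continuousOn₂ : ContinuousOn φ₂ (Set.Icc a b)
  monotoneOn₁ : MonotoneOn φ₁ (Set.Icc a b)
  monotoneOn₂ : MonotoneOn φ₂ (Set.Icc a b)
  strictMonoOn_add : StrictMonoOn (fun x => φ₁ x + φ₂ x) (Set.Icc a b)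

/-- Condition (CL): (C0), and both functions are Lipschitz on `[a, b]`. -/
structure CondCL (φ₁ φ₂ : ℝ → ℝ) (a b : ℝ) : Prop extends CondC0 φ₁ φ₂ a b where
  lipschitzOn₁ : ∃ K, LipschitzOnWith K φ₁ (Set.Icc a b)
  lipschitzOn₂ : ∃ K, LipschitzOnWith K φ₂ (Set.Icc a b)

/-- Condition (C1): (CL), both functions are `C¹` on `[a, b]` (one-sided at the end points),
and `φ₁' + φ₂' > 0` on `[a, b] \ {0}`. -/
structure CondC1 (φ₁ φ₂ : ℝ → ℝ) (a b : ℝ) : Prop extends CondCL φ₁ φ₂ a b where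
  contDiffOn₁ : ContDiffOn ℝ 1 φ₁ (Set.Icc a b)
  contDiffOn₂ : ContDiffOn ℝ 1 φ₂ (Set.Icc a b)
  deriv_pos : ∀ x ∈ Set.Icc a b \ {0},
    0 < derivWithin φ₁ (Set.Icc a b) x + derivWithin φ₂ (Set.Icc a b) x

open scoped MatrixOrder in
/-- The absolute value `|X| = (X* X)^{1/2}` of a complex square matrix. -/
def matAbs {n : ℕ} (X : Matrix (Fin n) (Fin n) ℂ) : Matrix (Fin n) (Fin n) ℂ :=
  CFC.abs X

/-- The set `M_n[a, b]` of matrices `X` for which the spectrum of `|X|` lies in `[a, b]`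
(`|X|` is self-adjoint, so its spectrum is real). -/
def matInterval (n : ℕ) (a b : ℝ) : Set (Matrix (Fin n) (Fin n) ℂ) :=
  {X | spectrum ℝ (matAbs X) ⊆ Set.Icc a b}

/-- `φ(X) = φ₁(|X|) - φ₂(|X*|)`, by functional calculus of self-adjoint matrices. -/
def phi {n : ℕ} (φ₁ φ₂ : ℝ → ℝ) (X : Matrix (Fin n) (Fin n) ℂ) : Matrix (Fin n) (Fin n) ℂ :=
  cfc φ₁ (matAbs X) - cfc φ₂ (matAbs Xᴴ)

/-- `X` is a global solution on `[0, ∞)` of `dX/dt = [φ(X), X]`, `X(0) = T`. As `φ₁`, `φ₂` are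
given on `[a, b]` only, a solution has to take its values in `M_n[a, b]`. -/
structure IsGlobalSolution {n : ℕ} (φ₁ φ₂ : ℝ → ℝ) (a b : ℝ) (T : Matrix (Fin n) (Fin n) ℂ)
    (X : ℝ → Matrix (Fin n) (Fin n) ℂ) : Prop where
  initial : X 0 = T
  mem : ∀ t, 0 ≤ t → X t ∈ matInterval n a b
  hasDeriv : ∀ t, 0 ≤ t → HasDerivWithinAt X ⁅phi φ₁ φ₂ (X t), X t⁆ (Set.Ici 0) t

/-- The similarity orbit `O(T) = {P T P⁻¹ : P ∈ GL(n, ℂ)}`. -/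
def similarityOrbit {n : ℕ} (T : Matrix (Fin n) (Fin n) ℂ) : Set (Matrix (Fin n) (Fin n) ℂ) :=
  {S | ∃ P : GL (Fin n) ℂ, S = P.val * T * P⁻¹.val}

/-- `T` is diagonalizable: it is similar to a diagonal matrix. -/
def IsDiagonalizable {n : ℕ} (T : Matrix (Fin n) (Fin n) ℂ) : Prop :=
  ∃ d : Fin n → ℂ, Matrix.diagonal d ∈ similarityOrbit T

open scoped Matrix.Norms.L2Operator in
/-- `X(t)` converges to `N` exponentially fast (in the operator norm) as `t → ∞`. -/
def ConvergesExponentially {n : ℕ} (X : ℝ → Matrix (Fin n) (Fin n) ℂ)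
    (N : Matrix (Fin n) (Fin n) ℂ) : Prop :=
  ∃ C > 0, ∃ c > 0, ∀ t : ℝ, 0 ≤ t → ‖X t - N‖ ≤ C * Real.exp (-c * t)

end MatrixFlow

end

/-! Existence. Extend `φ₁` and `φ₂` by constants beyond `[a, b]`. The field `[φ(X), X]` is then
locally Lipschitz, since functional calculus by a Lipschitz function is Lipschitz in the Frobenius
norm (`frobSq_cfc_sub_le`) and so are `|X|` and `|X*|` (`frobSq_matAbs_sub_le`). Monotonicity keeps
short Euler steps from increasing the operator norm (`eventually_norm_add_smul_lie_le`), so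
solutions are global and their norm stays at most `b`. If `a > 0`, the inverse of `X` obeys a flow
of the same kind (`phi_inverse`), which preserves the lower bound on the singular values.

Convergence. The Lyapunov function is the departure from normality `f = ‖X‖_F² - ∑ |λᵢ|²`; the
eigenvalues `λᵢ` do not move. Put `D = Re tr(φ(X)(X*X - XX*))` and `G = ‖|X| - |X*|‖_F²`. Then `f' =
-2D`, and, up to constants, `D` dominates `G` (`CondC1.exists_dissipation_bound`), `G` dominates
`|f|` (`exists_abs_frobSq_sub_le` with `frobSq_selfCommutator_le`), and `G` dominates `‖X'‖²`
(`frobSq_lie_phi_le`). So `f' ≤ -κ|f|`, `f` decays exponentially, and the length of the remaining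
trajectory does too (`exists_exponential_limit`). The limit is normal because `D` cannot stay
bounded away from zero.

Diagonalizability enters as a polynomial identity: every polynomial vanishing on a fixed finite set
`s` annihilates `X(t)`. This makes the spectral idempotents and a generalized inverse polynomials in
`X`, hence uniformly bounded along the flow. The generalized inverse keeps nonzero singular values
away from `0`, where `φ₁' + φ₂'` may vanish. The condition is also closed, and nearby matrices
satisfying it are similar, so the limit remains in the orbit of `T`. -/

namespace MatrixFlow

open scoped MatrixOrder Matrix.Norms.L2Operator

/-! ### Frobenius norm and its comparison with the operator norm. -/

section Frobenius

variable {ι κ : Type*} [Fintype ι] [Fintype κ]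

/-- The square of the Frobenius norm. -/
noncomputable def frobSq (X : Matrix ι κ ℂ) : ℝ := ∑ i, ∑ j, ‖X i j‖ ^ 2

lemma frobSq_nonneg (X : Matrix ι κ ℂ) : 0 ≤ frobSq X :=
  Finset.sum_nonneg fun _ _ => Finset.sum_nonneg fun _ _ => sq_nonneg _

lemma trace_mul_conjTranspose_self (X : Matrix ι κ ℂ) : (X * Xᴴ).trace = (frobSq X : ℂ) := by
  simp [Matrix.trace, Matrix.mul_apply, frobSq, Complex.mul_conj, Complex.normSq_eq_norm_sq]

lemma trace_conjTranspose_mul_self (X : Matrix ι κ ℂ) : (Xᴴ * X).trace = (frobSq X : ℂ) := by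
  rw [Matrix.trace_mul_comm, trace_mul_conjTranspose_self]

lemma frobSq_conjTranspose (X : Matrix ι κ ℂ) : frobSq Xᴴ = frobSq X := by
  unfold frobSq
  rw [Finset.sum_comm]
  simp

lemma frobSq_neg (X : Matrix ι κ ℂ) : frobSq (-X) = frobSq X := by
  simp [frobSq]

lemma frobSq_sub_comm (X Y : Matrix ι κ ℂ) : frobSq (X - Y) = frobSq (Y - X) := by
  rw [← frobSq_neg, neg_sub]

lemma frobSq_add_le (X Y : Matrix ι κ ℂ) : frobSq (X + Y) ≤ 2 * (frobSq X + frobSq Y) := by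
  simp only [frobSq, ← Finset.sum_add_distrib, Finset.mul_sum]
  refine Finset.sum_le_sum fun i _ => Finset.sum_le_sum fun j _ => ?_
  have h := norm_add_le (X i j) (Y i j)
  have h0 := norm_nonneg (X i j + Y i j)
  rw [Matrix.add_apply]
  nlinarith [sq_nonneg (‖X i j‖ - ‖Y i j‖)]

lemma frobSq_sub_le (X Y : Matrix ι κ ℂ) : frobSq (X - Y) ≤ 2 * (frobSq X + frobSq Y) := by
  rw [sub_eq_add_neg, ← frobSq_neg Y]
  exact frobSq_add_le _ _

lemma frobSq_eq_zero {X : Matrix ι κ ℂ} (h : frobSq X = 0) : X = 0 := by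
  ext i j
  have h1 := (Finset.sum_eq_zero_iff_of_nonneg
    (fun i _ => Finset.sum_nonneg fun j _ => sq_nonneg ‖X i j‖)).1 h i (Finset.mem_univ _)
  have h2 := (Finset.sum_eq_zero_iff_of_nonneg (fun j _ => sq_nonneg ‖X i j‖)).1 h1 j
    (Finset.mem_univ _)
  simpa using h2

lemma continuous_frobSq : Continuous (frobSq : Matrix ι κ ℂ → ℝ) := by
  unfold frobSq
  fun_prop

lemma norm_trace_mul_le (X Y : Matrix ι ι ℂ) :
    ‖(Xᴴ * Y).trace‖ ≤ (frobSq X + frobSq Y) / 2 := by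
  simp only [Matrix.trace, Matrix.diag_apply, Matrix.mul_apply, frobSq]
  rw [Finset.sum_comm]
  refine (norm_sum_le _ _).trans ?_
  rw [← Finset.sum_add_distrib, Finset.sum_div]
  refine Finset.sum_le_sum fun i _ => (norm_sum_le _ _).trans ?_
  rw [← Finset.sum_add_distrib, Finset.sum_div]
  refine Finset.sum_le_sum fun j _ => ?_
  rw [norm_mul, Matrix.conjTranspose_apply, norm_star]
  nlinarith [sq_nonneg (‖X i j‖ - ‖Y i j‖)]

variable [DecidableEq ι]

lemma norm_toEuclideanCLM_sq_le (X : Matrix ι ι ℂ) (v : EuclideanSpace ℂ ι) :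
    ‖Matrix.toEuclideanCLM (𝕜 := ℂ) X v‖ ^ 2 ≤ frobSq X * ‖v‖ ^ 2 := by
  rw [EuclideanSpace.norm_sq_eq, EuclideanSpace.norm_sq_eq, frobSq, Finset.sum_mul]
  refine Finset.sum_le_sum fun i _ => ?_
  have h : (Matrix.toEuclideanCLM (𝕜 := ℂ) X v) i = ∑ j, X i j * v j := by
    simp [Matrix.mulVec, dotProduct]
  rw [h]
  calc ‖∑ j, X i j * v j‖ ^ 2 ≤ (∑ j, ‖X i j‖ * ‖v j‖) ^ 2 := by
        gcongr
        exact (norm_sum_le _ _).trans (by simp)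
    _ ≤ _ := Finset.sum_mul_sq_le_sq_mul_sq _ _ _

lemma norm_sq_le_frobSq (X : Matrix ι ι ℂ) : ‖X‖ ^ 2 ≤ frobSq X := by
  have h : ‖X‖ ≤ √(frobSq X) := by
    rw [Matrix.cstar_norm_def]
    refine ContinuousLinearMap.opNorm_le_bound _ (Real.sqrt_nonneg _) fun v => ?_
    refine abs_le_of_sq_le_sq' ?_ (by positivity) |>.2
    rw [mul_pow, Real.sq_sqrt (frobSq_nonneg X)]
    exact norm_toEuclideanCLM_sq_le X v
  calc ‖X‖ ^ 2 ≤ √(frobSq X) ^ 2 := by gcongr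
    _ = _ := Real.sq_sqrt (frobSq_nonneg X)

lemma sum_norm_sq_col_le (X Y : Matrix ι ι ℂ) (j : ι) :
    ∑ i, ‖(X * Y) i j‖ ^ 2 ≤ ‖X‖ ^ 2 * ∑ i, ‖Y i j‖ ^ 2 := by
  have h := (Matrix.toEuclideanCLM (𝕜 := ℂ) X).le_opNorm (WithLp.toLp 2 (fun i => Y i j))
  have h2 := pow_le_pow_left₀ (norm_nonneg _) h 2
  rw [mul_pow, EuclideanSpace.norm_sq_eq, EuclideanSpace.norm_sq_eq, ← Matrix.cstar_norm_def] at h2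
  simpa [Matrix.mulVec, dotProduct, Matrix.mul_apply] using h2

lemma frobSq_mul_le_left (X Y : Matrix ι ι ℂ) : frobSq (X * Y) ≤ ‖X‖ ^ 2 * frobSq Y := by
  unfold frobSq
  rw [Finset.sum_comm, Finset.sum_comm (f := fun i j => ‖Y i j‖ ^ 2), Finset.mul_sum]
  exact Finset.sum_le_sum fun j _ => sum_norm_sq_col_le X Y j

lemma frobSq_mul_le_right (X Y : Matrix ι ι ℂ) : frobSq (X * Y) ≤ frobSq X * ‖Y‖ ^ 2 := by
  rw [← frobSq_conjTranspose, Matrix.conjTranspose_mul, ← frobSq_conjTranspose X,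
    ← Matrix.l2_opNorm_conjTranspose Y, mul_comm]
  exact frobSq_mul_le_left _ _

lemma frobSq_one : frobSq (1 : Matrix ι ι ℂ) = Fintype.card ι := by
  have h := trace_mul_conjTranspose_self (1 : Matrix ι ι ℂ)
  rw [Matrix.conjTranspose_one, mul_one, Matrix.trace_one] at h
  exact_mod_cast h.symm

lemma frobSq_le_card_mul (X : Matrix ι ι ℂ) : frobSq X ≤ Fintype.card ι * ‖X‖ ^ 2 := by
  have h := frobSq_mul_le_left X 1
  rwa [mul_one, frobSq_one, mul_comm] at h

end Frobenius

/-! ### Functional calculus of Hermitian matrices and joint spectral weights. -/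

section Spectral

variable {ι : Type*} [Fintype ι] [DecidableEq ι]

lemma continuousOn_spectrum (A : Matrix ι ι ℂ) (f : ℝ → ℝ) : ContinuousOn f (spectrum ℝ A) :=
  Matrix.finite_real_spectrum.continuousOn f

lemma cfc_mul_eq (A : Matrix ι ι ℂ) (f g : ℝ → ℝ) :
    cfc f A * cfc g A = cfc (fun x => f x * g x) A :=
  (cfc_mul f g A (continuousOn_spectrum A f) (continuousOn_spectrum A g)).symm

lemma isSelfAdjoint_cfc (A : Matrix ι ι ℂ) (f : ℝ → ℝ) : (cfc f A)ᴴ = cfc f A :=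
  (cfc_predicate f A : IsSelfAdjoint _)

lemma cfc_eq_conj {A : Matrix ι ι ℂ} (hA : A.IsHermitian) (f : ℝ → ℝ) :
    cfc f A = (hA.eigenvectorUnitary : Matrix ι ι ℂ) *
      Matrix.diagonal (fun i => (f (hA.eigenvalues i) : ℂ)) *
        (hA.eigenvectorUnitary : Matrix ι ι ℂ)ᴴ := by
  rw [hA.cfc_eq, Matrix.IsHermitian.cfc, Unitary.conjStarAlgAut_apply]
  rfl

lemma cfc_self {A : Matrix ι ι ℂ} (hA : A.IsHermitian) : cfc (fun x : ℝ => x) A = A :=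
  cfc_id' ℝ A (ha := hA)

lemma cfc_one_eq {A : Matrix ι ι ℂ} (hA : A.IsHermitian) : cfc (fun _ : ℝ => (1 : ℝ)) A = 1 :=
  cfc_const_one ℝ A (ha := hA)

lemma cfc_cfc_eq {A : Matrix ι ι ℂ} (hA : A.IsHermitian) (f g : ℝ → ℝ) :
    cfc f (cfc g A) = cfc (fun x => f (g x)) A :=
  (cfc_comp' f g A ((Matrix.finite_real_spectrum.image _).continuousOn _)
    (continuousOn_spectrum _ _) hA).symm

lemma aeval_cfc_eq {A : Matrix ι ι ℂ} (hA : A.IsHermitian) (q : Polynomial ℝ) (f : ℝ → ℝ) :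
    Polynomial.aeval (cfc f A) q = cfc (fun x => q.eval (f x)) A :=
  (cfc_map_polynomial q f A hA (continuousOn_spectrum _ _)).symm

/-- Joint spectral weights of two Hermitian matrices. -/
theorem exists_spectral_weights {A B : Matrix ι ι ℂ} (hA : A.IsHermitian) (hB : B.IsHermitian) :
    ∃ (w : ι → ι → ℝ) (α β : ι → ℝ), (∀ i j, 0 ≤ w i j) ∧ (∀ i, α i ∈ spectrum ℝ A) ∧
      (∀ j, β j ∈ spectrum ℝ B) ∧ ∀ f g : ℝ → ℝ,
        (cfc f A * cfc g B).trace = ((∑ i, ∑ j, w i j * (f (α i) * g (β j)) : ℝ) : ℂ) := by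
  set U : Matrix ι ι ℂ := (hA.eigenvectorUnitary : Matrix ι ι ℂ)
  set V : Matrix ι ι ℂ := (hB.eigenvectorUnitary : Matrix ι ι ℂ)
  -- The weights are the squared overlaps of the two eigenbases; they do not depend on `f` and `g`,
  -- so trace inequalities reduce to scalar ones at pairs of eigenvalues.
  refine ⟨fun i j => ‖(Uᴴ * V) i j‖ ^ 2, hA.eigenvalues, hB.eigenvalues, fun _ _ => sq_nonneg _,
    hA.eigenvalues_mem_spectrum_real, hB.eigenvalues_mem_spectrum_real, fun f g => ?_⟩
  rw [cfc_eq_conj hA, cfc_eq_conj hB]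
  change (U * Matrix.diagonal _ * Uᴴ * (V * Matrix.diagonal _ * Vᴴ)).trace = _
  have h1 : ∀ D E : Matrix ι ι ℂ, (U * D * Uᴴ * (V * E * Vᴴ)).trace
      = (D * (Uᴴ * V) * E * (Uᴴ * V)ᴴ).trace := by
    intro D E
    rw [Matrix.conjTranspose_mul, Matrix.conjTranspose_conjTranspose]
    simp only [mul_assoc]
    rw [Matrix.trace_mul_comm]
    simp only [mul_assoc]
  rw [h1]
  simp only [Matrix.trace, Matrix.diag_apply]
  push_cast
  refine Finset.sum_congr rfl fun i _ => ?_
  rw [Matrix.mul_apply]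
  refine Finset.sum_congr rfl fun j _ => ?_
  rw [Matrix.mul_diagonal, Matrix.diagonal_mul, Matrix.conjTranspose_apply]
  have h2 : (Uᴴ * V) i j * star ((Uᴴ * V) i j) = ((‖(Uᴴ * V) i j‖ : ℂ)) ^ 2 := by
    rw [Complex.star_def, Complex.mul_conj, Complex.normSq_eq_norm_sq]
    push_cast
    rfl
  rw [← h2]
  ring

/-- Joint spectral weights express the Frobenius distance of functions of Hermitian matrices. -/
lemma frobSq_cfc_sub_cfc {A B : Matrix ι ι ℂ} {w : ι → ι → ℝ} {α β : ι → ℝ}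
    (h : ∀ f g : ℝ → ℝ,
        (cfc f A * cfc g B).trace = ((∑ i, ∑ j, w i j * (f (α i) * g (β j)) : ℝ) : ℂ))
    (hA : A.IsHermitian) (hB : B.IsHermitian) (f g : ℝ → ℝ) :
    frobSq (cfc f A - cfc g B) = ∑ i, ∑ j, w i j * (f (α i) - g (β j)) ^ 2 := by
  have h0 := trace_mul_conjTranspose_self (cfc f A - cfc g B)
  rw [Matrix.conjTranspose_sub, isSelfAdjoint_cfc, isSelfAdjoint_cfc] at h0
  have h1 := h (fun x => f x * f x) (fun _ => 1)
  have h2 := h (fun _ => 1) (fun x => g x * g x)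
  have h3 := h f g
  rw [cfc_one_eq hB, mul_one, ← cfc_mul_eq] at h1
  rw [cfc_one_eq hA, one_mul, ← cfc_mul_eq] at h2
  have h4 : ((cfc f A - cfc g B) * (cfc f A - cfc g B)).trace = (cfc f A * cfc f A).trace
      - 2 * (cfc f A * cfc g B).trace + (cfc g B * cfc g B).trace := by
    simp only [mul_sub, sub_mul, Matrix.trace_sub]
    rw [Matrix.trace_mul_comm (cfc g B) (cfc f A)]
    ring
  rw [h4, h1, h2, h3] at h0
  have h5 : frobSq (cfc f A - cfc g B) = _ := (Complex.ofReal_injective (by exact_mod_cast h0)).symm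
  rw [h5]
  simp only [Finset.mul_sum, ← Finset.sum_sub_distrib, ← Finset.sum_add_distrib]
  refine Finset.sum_congr rfl fun i _ => Finset.sum_congr rfl fun j _ => ?_
  ring

/-- Functional calculus by a Lipschitz function is Lipschitz in the Frobenius norm. -/
lemma frobSq_cfc_sub_le {A B : Matrix ι ι ℂ} (hA : A.IsHermitian) (hB : B.IsHermitian)
    {f : ℝ → ℝ} {K : ℝ} (hf : ∀ x ∈ spectrum ℝ A, ∀ y ∈ spectrum ℝ B, |f x - f y| ≤ K * |x - y|) :
    frobSq (cfc f A - cfc f B) ≤ K ^ 2 * frobSq (A - B) := by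
  obtain ⟨w, α, β, hw, hα, hβ, h⟩ := exists_spectral_weights hA hB
  have hid := frobSq_cfc_sub_cfc h hA hB (fun x => x) (fun x => x)
  rw [cfc_self hA, cfc_self hB] at hid
  rw [frobSq_cfc_sub_cfc h hA hB, hid]
  simp only [Finset.mul_sum]
  refine Finset.sum_le_sum fun i _ => Finset.sum_le_sum fun j _ => ?_
  have h1 := hf _ (hα i) _ (hβ j)
  have h2 : (f (α i) - f (β j)) ^ 2 ≤ K ^ 2 * (α i - β j) ^ 2 := by
    rw [← sq_abs, ← sq_abs (α i - β j), ← mul_pow]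
    gcongr
  calc w i j * (f (α i) - f (β j)) ^ 2 ≤ w i j * (K ^ 2 * (α i - β j) ^ 2) :=
        mul_le_mul_of_nonneg_left h2 (hw i j)
    _ = _ := by ring

end Spectral

/-! ### The absolute values `|X|` and `|X*|`. -/

section AbsoluteValue

variable {n : ℕ} (X Y : Matrix (Fin n) (Fin n) ℂ)

lemma matAbs_mul_self : matAbs X * matAbs X = Xᴴ * X := CFC.abs_mul_abs X

lemma matAbs_nonneg : 0 ≤ matAbs X := CFC.abs_nonneg X

lemma isHermitian_matAbs : (matAbs X).IsHermitian := (matAbs_nonneg X).isSelfAdjoint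

variable {X} in
lemma nonneg_of_mem_spectrum_matAbs {x : ℝ} (hx : x ∈ spectrum ℝ (matAbs X)) : 0 ≤ x :=
  spectrum_nonneg_of_nonneg (matAbs_nonneg X) hx

lemma matAbs_eq_of_sq {A : Matrix (Fin n) (Fin n) ℂ} (hA : 0 ≤ A) (h : A * A = Xᴴ * X) :
    matAbs X = A :=
  (CFC.sqrt_eq_iff _ _ (star_mul_self_nonneg X) hA).2 h

lemma cfc_sq_matAbs : cfc (fun x : ℝ => x ^ 2) (matAbs X) = Xᴴ * X := by
  have h := cfc_mul_eq (matAbs X) (fun x => x) (fun x => x)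
  rw [cfc_self (isHermitian_matAbs X), matAbs_mul_self] at h
  rw [h]
  simp only [sq]

lemma norm_matAbs : ‖matAbs X‖ = ‖X‖ := by
  have h1 : ‖matAbs X‖ * ‖matAbs X‖ = ‖X‖ * ‖X‖ := by
    rw [← Matrix.l2_opNorm_conjTranspose_mul_self, ← Matrix.l2_opNorm_conjTranspose_mul_self,
      (isHermitian_matAbs X).eq, matAbs_mul_self]
  exact (mul_self_inj (norm_nonneg _) (norm_nonneg _)).1 h1

variable {X} in
lemma le_norm_of_mem_spectrum_matAbs {x : ℝ} (hx : x ∈ spectrum ℝ (matAbs X)) : x ≤ ‖X‖ := by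
  have h := norm_apply_le_norm_cfc (fun x : ℝ => x) (matAbs X) hx (continuousOn_spectrum _ _)
    (isHermitian_matAbs X)
  rw [cfc_self (isHermitian_matAbs X), norm_matAbs] at h
  exact (le_abs_self x).trans h

/-- A simultaneous polynomial interpolation of the functional calculi of `|X|` and `|X*|`. -/
lemma exists_polynomial_cfc_matAbs (f : ℝ → ℝ) : ∃ q : Polynomial ℝ,
    cfc f (matAbs X) = Polynomial.aeval (Xᴴ * X) q ∧
    cfc f (matAbs Xᴴ) = Polynomial.aeval (X * Xᴴ) q := by
  classical
  obtain ⟨s, hs⟩ := ((Matrix.finite_real_spectrum (A := matAbs X)).union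
    (Matrix.finite_real_spectrum (A := matAbs Xᴴ))).exists_finset
  have hnn : ∀ x ∈ s, 0 ≤ x := fun x hx => by
    rcases (hs x).1 hx with h | h
    exacts [nonneg_of_mem_spectrum_matAbs h, nonneg_of_mem_spectrum_matAbs h]
  have hinj : Set.InjOn (fun x : ℝ => x ^ 2) s := fun x hx y hy h =>
    (sq_eq_sq₀ (hnn x hx) (hnn y hy)).1 h
  -- The nodes are squares because the polynomial is evaluated at `X*X = |X|²`; they are distinct
  -- since both spectra are nonnegative.
  refine ⟨Lagrange.interpolate s (fun x => x ^ 2) f, ?_⟩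
  have key : ∀ Z : Matrix (Fin n) (Fin n) ℂ, (∀ x ∈ spectrum ℝ (matAbs Z), x ∈ s) →
      cfc f (matAbs Z) =
        Polynomial.aeval (Zᴴ * Z) (Lagrange.interpolate s (fun x => x ^ 2) f) := by
    intro Z hZ
    rw [← cfc_sq_matAbs, aeval_cfc_eq (isHermitian_matAbs Z)]
    exact cfc_congr fun x hx => (Lagrange.eval_interpolate_at_node f hinj (hZ x hx)).symm
  constructor
  · exact key X fun x hx => (hs x).2 (Or.inl hx)
  · have := key Xᴴ fun x hx => (hs x).2 (Or.inr hx)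
    rwa [Matrix.conjTranspose_conjTranspose] at this

lemma mul_aeval_eq_aeval_mul (q : Polynomial ℝ) :
    X * Polynomial.aeval (Y * X) q = Polynomial.aeval (X * Y) q * X := by
  induction q using Polynomial.induction_on' with
  | add p q hp hq => simp only [map_add, mul_add, add_mul, hp, hq]
  | monomial k c =>
    simp only [Polynomial.aeval_monomial, ← Algebra.smul_def, mul_smul_comm, smul_mul_assoc]
    congr 1
    induction k with
    | zero => simp
    | succ k ih => rw [pow_succ, ← mul_assoc, ih, pow_succ]; simp only [mul_assoc]

lemma trace_aeval_comm (q : Polynomial ℝ) :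
    (Polynomial.aeval (X * Y) q).trace = (Polynomial.aeval (Y * X) q).trace := by
  induction q using Polynomial.induction_on' with
  | add p q hp hq => simp only [map_add, Matrix.trace_add, hp, hq]
  | monomial k c =>
    simp only [Polynomial.aeval_monomial, ← Algebra.smul_def, Matrix.trace_smul]
    congr 1
    cases k with
    | zero => simp
    | succ k =>
      have h : (X * Y) ^ (k + 1) = X * (Y * X) ^ k * Y := by
        induction k with
        | zero => simp
        | succ k ih => rw [pow_succ, ih, pow_succ]; simp only [mul_assoc]
      rw [h, mul_assoc, Matrix.trace_mul_comm, pow_succ, mul_assoc]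

/-- The polar intertwining relation. -/
lemma mul_cfc_matAbs (f : ℝ → ℝ) : X * cfc f (matAbs X) = cfc f (matAbs Xᴴ) * X := by
  obtain ⟨q, h1, h2⟩ := exists_polynomial_cfc_matAbs X f
  rw [h1, h2, mul_aeval_eq_aeval_mul]

lemma trace_cfc_matAbs (f : ℝ → ℝ) :
    (cfc f (matAbs Xᴴ)).trace = (cfc f (matAbs X)).trace := by
  obtain ⟨q, h1, h2⟩ := exists_polynomial_cfc_matAbs X f
  rw [h1, h2, trace_aeval_comm]

variable {X Y} in
/-- `|X⁻¹| = |X*|⁻¹`, in terms of functional calculus. -/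
lemma cfc_comp_inv_matAbs (h : Y * X = 1) (f : ℝ → ℝ) :
    cfc (fun x => f x⁻¹) (matAbs Y) = cfc f (matAbs Xᴴ) := by
  have h' : X * Y = 1 := mul_eq_one_comm.1 h
  have hs : ∀ x ∈ spectrum ℝ (matAbs Xᴴ), x ≠ 0 := by
    rintro x hx rfl
    refine spectrum.zero_notMem ℝ ?_ hx
    have h2 : matAbs Xᴴ * (matAbs Xᴴ * (Yᴴ * Y)) = 1 := by
      rw [← mul_assoc, matAbs_mul_self, Matrix.conjTranspose_conjTranspose, mul_assoc,
        ← mul_assoc Xᴴ, ← Matrix.conjTranspose_mul, h, Matrix.conjTranspose_one, one_mul, h']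
    exact IsUnit.of_mul_eq_one _ h2
  have hA := isHermitian_matAbs Xᴴ
  have hY : matAbs Y = cfc (fun x : ℝ => x⁻¹) (matAbs Xᴴ) := by
    refine matAbs_eq_of_sq Y (cfc_nonneg fun x hx =>
      inv_nonneg.2 (nonneg_of_mem_spectrum_matAbs hx)) ?_
    rw [cfc_mul_eq]
    have h3 : cfc (fun x : ℝ => x⁻¹ * x⁻¹) (matAbs Xᴴ) * (X * Xᴴ) = 1 := by
      have h5 := cfc_sq_matAbs Xᴴ
      rw [Matrix.conjTranspose_conjTranspose] at h5
      rw [← h5, cfc_mul_eq, ← cfc_one_eq hA]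
      refine cfc_congr fun x hx => ?_
      have := hs x hx
      field_simp
    have h4 : X * Xᴴ * (Yᴴ * Y) = 1 := by
      rw [mul_assoc, ← mul_assoc Xᴴ, ← Matrix.conjTranspose_mul, h, Matrix.conjTranspose_one,
        one_mul, h']
    calc _ = cfc (fun x : ℝ => x⁻¹ * x⁻¹) (matAbs Xᴴ) * (X * Xᴴ * (Yᴴ * Y)) := by
          rw [h4, mul_one]
      _ = _ := by rw [← mul_assoc, h3, one_mul]
  rw [hY, cfc_cfc_eq hA]
  simp only [inv_inv]

end AbsoluteValue

/-! ### Lipschitz continuity of the absolute value through the Hermitian dilation. -/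

section Dilation

variable {n : ℕ} (X Y : Matrix (Fin n) (Fin n) ℂ)

lemma frobSq_fromBlocks (A B C D : Matrix (Fin n) (Fin n) ℂ) :
    frobSq (Matrix.fromBlocks A B C D) = frobSq A + frobSq B + frobSq C + frobSq D := by
  simp [frobSq, Fintype.sum_sum_type, Finset.sum_add_distrib]
  ring

lemma fromBlocks_diag_nonneg {A D : Matrix (Fin n) (Fin n) ℂ} (hA : 0 ≤ A) (hD : 0 ≤ D) :
    0 ≤ Matrix.fromBlocks A 0 0 D := by
  have hA1 := CFC.sqrt_mul_sqrt_self A hA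
  have hD1 := CFC.sqrt_mul_sqrt_self D hD
  have hA2 : (CFC.sqrt A)ᴴ = CFC.sqrt A := (CFC.sqrt_nonneg A).isSelfAdjoint
  have hD2 : (CFC.sqrt D)ᴴ = CFC.sqrt D := (CFC.sqrt_nonneg D).isSelfAdjoint
  have h : Matrix.fromBlocks A 0 0 D
      = star (Matrix.fromBlocks (CFC.sqrt A) 0 0 (CFC.sqrt D)) *
        Matrix.fromBlocks (CFC.sqrt A) 0 0 (CFC.sqrt D) := by
    rw [Matrix.star_eq_conjTranspose, Matrix.fromBlocks_conjTranspose, Matrix.fromBlocks_multiply,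
      hA2, hD2]
    simp [hA1, hD1]
  rw [h]
  exact star_mul_self_nonneg _

lemma isHermitian_dilation : (Matrix.fromBlocks 0 Xᴴ X 0).IsHermitian := by
  rw [Matrix.IsHermitian, Matrix.fromBlocks_conjTranspose]
  simp

/-- The absolute value of the Hermitian dilation of `X`. -/
lemma cfc_abs_dilation : cfc (fun x : ℝ => |x|) (Matrix.fromBlocks 0 Xᴴ X 0)
    = Matrix.fromBlocks (matAbs X) 0 0 (matAbs Xᴴ) := by
  have h := CFC.abs_eq_cfc_norm (Matrix.fromBlocks 0 Xᴴ X 0) (isHermitian_dilation X)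
  simp only [Real.norm_eq_abs] at h
  rw [← h]
  refine (CFC.sqrt_eq_iff _ _ (star_mul_self_nonneg _)
    (fromBlocks_diag_nonneg (matAbs_nonneg X) (matAbs_nonneg Xᴴ))).2 ?_
  rw [Matrix.star_eq_conjTranspose, (isHermitian_dilation X).eq, Matrix.fromBlocks_multiply,
    Matrix.fromBlocks_multiply]
  simp [matAbs_mul_self]

/-- The absolute value is Lipschitz in the Frobenius norm. -/
lemma frobSq_matAbs_sub_le : frobSq (matAbs X - matAbs Y) + frobSq (matAbs Xᴴ - matAbs Yᴴ)
    ≤ 2 * frobSq (X - Y) := by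
  have h := frobSq_cfc_sub_le (isHermitian_dilation X) (isHermitian_dilation Y)
    (f := fun x => |x|) (K := 1)
    (fun x _ y _ => by simpa using abs_abs_sub_abs_le_abs_sub x y)
  rw [cfc_abs_dilation, cfc_abs_dilation, sub_eq_add_neg, Matrix.fromBlocks_neg,
    Matrix.fromBlocks_add, frobSq_fromBlocks, sub_eq_add_neg (Matrix.fromBlocks 0 _ _ _),
    Matrix.fromBlocks_neg, Matrix.fromBlocks_add, frobSq_fromBlocks] at h
  simp only [← sub_eq_add_neg, sub_zero] at h
  rw [← Matrix.conjTranspose_sub, frobSq_conjTranspose] at h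
  have h0 : frobSq (0 : Matrix (Fin n) (Fin n) ℂ) = 0 := by simp [frobSq]
  linarith

end Dilation

/-! ### Singular value bounds in terms of norms of (generalized) inverses. -/

section SingularValues

variable {n : ℕ} {X Y G T : Matrix (Fin n) (Fin n) ℂ} {a b : ℝ}

lemma norm_mul_cfc_matAbs_le {g : ℝ → ℝ} {c : ℝ} (hc : 0 ≤ c)
    (h : ∀ x ∈ spectrum ℝ (matAbs X), |x * g x| ≤ c) : ‖X * cfc g (matAbs X)‖ ≤ c := by
  refine abs_le_of_sq_le_sq' ?_ hc |>.2
  rw [sq, ← Matrix.l2_opNorm_conjTranspose_mul_self, Matrix.conjTranspose_mul, isSelfAdjoint_cfc,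
    mul_assoc, ← mul_assoc Xᴴ, ← cfc_sq_matAbs, cfc_mul_eq, cfc_mul_eq]
  refine norm_cfc_le (sq_nonneg c) fun x hx => ?_
  have h1 := h x hx
  rw [Real.norm_eq_abs, show g x * (x ^ 2 * g x) = (x * g x) ^ 2 by ring, abs_pow]
  gcongr

lemma norm_le_of_mem_matInterval (hb : 0 ≤ b) (h : X ∈ matInterval n a b) : ‖X‖ ≤ b := by
  have h1 := norm_mul_cfc_matAbs_le (X := X) (g := fun _ => 1) hb fun x hx => by
    rw [mul_one, abs_of_nonneg (nonneg_of_mem_spectrum_matAbs hx)]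
    exact (h hx).2
  rwa [cfc_one_eq (isHermitian_matAbs X), mul_one] at h1

/-- Let `P` be the spectral projection of `|X|` at `σ`. Then `‖XP‖ ≤ σ`, so a factorization `P =
PG(XP)` forces `‖P‖ ≤ ‖P‖‖G‖σ`, and `‖P‖` cancels. -/
lemma one_le_norm_mul_of_spectral_projection {σ : ℝ} (hσ : σ ∈ spectrum ℝ (matAbs X))
    (h : ∀ P : Matrix (Fin n) (Fin n) ℂ, P * P = P → Xᴴ * X * P = (σ ^ 2 : ℝ) • P →
      P * (Xᴴ * X) = (σ ^ 2 : ℝ) • P → P = P * G * (X * P)) : 1 ≤ ‖G‖ * σ := by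
  classical
  set p : ℝ → ℝ := fun x => if x = σ then 1 else 0 with hp
  have hσ0 := nonneg_of_mem_spectrum_matAbs hσ
  set P := cfc p (matAbs X) with hP
  have h1 : (1 : ℝ) ≤ ‖P‖ := by
    have := norm_apply_le_norm_cfc p (matAbs X) hσ (continuousOn_spectrum _ _)
      (isHermitian_matAbs X)
    simpa [hp] using this
  have hXP : ‖X * P‖ ≤ σ := norm_mul_cfc_matAbs_le hσ0 fun x _ => by
    by_cases hx : x = σ
    · simp [hp, hx, abs_of_nonneg hσ0]
    · simpa [hp, hx] using hσ0
  have hsm : ∀ g : ℝ → ℝ, (∀ x, g x = (σ ^ 2 : ℝ) • p x) →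
      cfc g (matAbs X) = (σ ^ 2 : ℝ) • P := fun g hg => by
    rw [hP, ← cfc_smul _ p (matAbs X) (continuousOn_spectrum _ _)]
    exact cfc_congr fun x _ => hg x
  have hPP : P = P * G * (X * P) := by
    refine h P ?_ ?_ ?_
    · rw [hP, cfc_mul_eq]
      exact cfc_congr fun x _ => by simp [hp]
    · rw [← cfc_sq_matAbs, hP, cfc_mul_eq]
      refine hsm _ fun x => ?_
      by_cases hx : x = σ <;> simp [hp, hx]
    · rw [← cfc_sq_matAbs, hP, cfc_mul_eq]
      refine hsm _ fun x => ?_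
      by_cases hx : x = σ <;> simp [hp, hx]
  have h2 : ‖P‖ ≤ ‖P‖ * ‖G‖ * σ := by
    calc ‖P‖ = ‖P * G * (X * P)‖ := congrArg _ hPP
      _ ≤ ‖P * G‖ * ‖X * P‖ := norm_mul_le _ _
      _ ≤ _ := by gcongr; exact norm_mul_le _ _
  nlinarith

/-- A generalized inverse of `X` bounds the nonzero singular values of `X` from below. -/
lemma one_le_norm_mul_of_generalized_inverse (h : X * G * X = X) {σ : ℝ}
    (hσ : σ ∈ spectrum ℝ (matAbs X)) (h0 : σ ≠ 0) : 1 ≤ ‖G‖ * σ := by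
  refine one_le_norm_mul_of_spectral_projection hσ fun P hPP h1 h2 => ?_
  have h3 : (σ ^ 2 : ℝ) • P = (σ ^ 2 : ℝ) • (P * G * (X * P)) := by
    calc (σ ^ 2 : ℝ) • P = P * (Xᴴ * X) * P := by rw [h2, smul_mul_assoc, hPP]
      _ = P * (Xᴴ * (X * G * X)) * P := by rw [h]
      _ = P * (Xᴴ * X) * (G * (X * P)) := by simp only [mul_assoc]
      _ = _ := by rw [h2, smul_mul_assoc, mul_assoc]
  exact smul_right_injective _ (pow_ne_zero 2 h0) h3

lemma one_le_norm_mul_of_inverse (h : Y * X = 1) {σ : ℝ}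
    (hσ : σ ∈ spectrum ℝ (matAbs X)) : 1 ≤ ‖Y‖ * σ := by
  refine one_le_norm_mul_of_spectral_projection hσ fun P hPP _ _ => ?_
  rw [mul_assoc, ← mul_assoc Y, h, one_mul, hPP]

lemma mem_matInterval_of_inverse (ha : 0 < a) (hX : ‖X‖ ≤ b) (h : Y * X = 1) (hY : ‖Y‖ ≤ a⁻¹) :
    X ∈ matInterval n a b := by
  intro σ hσ
  have h0 := nonneg_of_mem_spectrum_matAbs hσ
  refine ⟨?_, (le_norm_of_mem_spectrum_matAbs hσ).trans hX⟩
  have h1 := one_le_norm_mul_of_inverse h hσ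
  have h2 : 1 ≤ a⁻¹ * σ := h1.trans (by gcongr)
  rwa [inv_mul_eq_div, le_div_iff₀ ha, one_mul] at h2

lemma mem_matInterval_zero (hX : ‖X‖ ≤ b) : X ∈ matInterval n 0 b := fun _ hσ =>
  ⟨nonneg_of_mem_spectrum_matAbs hσ, (le_norm_of_mem_spectrum_matAbs hσ).trans hX⟩

lemma exists_inverse_of_mem_matInterval (ha : 0 < a) (h : X ∈ matInterval n a b) :
    ∃ Y, Y * X = 1 ∧ ‖Y‖ ≤ a⁻¹ := by
  have hA := isHermitian_matAbs X
  have hpos : ∀ x ∈ spectrum ℝ (matAbs X), 0 < x := fun x hx => ha.trans_le (h hx).1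
  set C := cfc (fun x : ℝ => (x ^ 2)⁻¹) (matAbs X) with hC
  have h1 : C * (Xᴴ * X) = 1 := by
    rw [← cfc_sq_matAbs, hC, cfc_mul_eq, ← cfc_one_eq hA]
    refine cfc_congr fun x hx => ?_
    have := (hpos x hx).ne'
    field_simp
  refine ⟨C * Xᴴ, by rw [mul_assoc, h1], ?_⟩
  rw [← Matrix.l2_opNorm_conjTranspose, Matrix.conjTranspose_mul,
    Matrix.conjTranspose_conjTranspose, isSelfAdjoint_cfc]
  refine norm_mul_cfc_matAbs_le (by positivity) fun x hx => ?_
  have hx0 := hpos x hx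
  rw [show x * (x ^ 2)⁻¹ = x⁻¹ by field_simp, abs_of_pos (by positivity)]
  exact inv_anti₀ ha (h hx).1

/-- Membership is encoded by the norms of `X` and, when `a > 0`, of its inverse, and both are
invariant under adjoints. -/
lemma mem_matInterval_conjTranspose (ha : 0 ≤ a) (hb : 0 ≤ b) (h : X ∈ matInterval n a b) :
    Xᴴ ∈ matInterval n a b := by
  have h1 : ‖Xᴴ‖ ≤ b := by
    rw [Matrix.l2_opNorm_conjTranspose]
    exact norm_le_of_mem_matInterval hb h
  rcases ha.eq_or_lt with rfl | ha
  · exact mem_matInterval_zero h1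
  · obtain ⟨Y, hY, hn⟩ := exists_inverse_of_mem_matInterval ha h
    refine mem_matInterval_of_inverse (Y := Yᴴ) ha h1 ?_
      (by rwa [Matrix.l2_opNorm_conjTranspose])
    rw [← Matrix.conjTranspose_mul, mul_eq_one_comm.1 hY, Matrix.conjTranspose_one]

end SingularValues

/-! ### Lipschitz and norm estimates for the vector field. -/

section VectorField

variable {n : ℕ} {φ₁ φ₂ : ℝ → ℝ}

/-- The vector field is dominated by the distance of `|X|` and `|X*|`. -/
lemma frobSq_lie_phi_le {X : Matrix (Fin n) (Fin n) ℂ} {K : ℝ} {S : Set ℝ}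
    (h₁ : ∀ x ∈ S, ∀ y ∈ S, |φ₁ x - φ₁ y| ≤ K * |x - y|)
    (h₂ : ∀ x ∈ S, ∀ y ∈ S, |φ₂ x - φ₂ y| ≤ K * |x - y|)
    (hX : spectrum ℝ (matAbs X) ⊆ S) (hX' : spectrum ℝ (matAbs Xᴴ) ⊆ S) :
    frobSq ⁅phi φ₁ φ₂ X, X⁆ ≤ 4 * K ^ 2 * ‖X‖ ^ 2 * frobSq (matAbs X - matAbs Xᴴ) := by
  have hA := isHermitian_matAbs X
  have hB := isHermitian_matAbs Xᴴ
  -- The intertwining relation regroups the commutator into differences of one function at `|X|` and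
  -- at `|X*|`.
  have h : ⁅phi φ₁ φ₂ X, X⁆ = (cfc φ₁ (matAbs X) - cfc φ₁ (matAbs Xᴴ)) * X
      - X * (cfc φ₂ (matAbs X) - cfc φ₂ (matAbs Xᴴ)) := by
    rw [Ring.lie_def, phi, sub_mul, sub_mul, mul_sub, mul_sub, mul_cfc_matAbs, mul_cfc_matAbs]
    abel
  rw [h]
  have e1 := frobSq_cfc_sub_le hA hB fun x hx y hy => h₁ x (hX hx) y (hX' hy)
  have e2 := frobSq_cfc_sub_le hA hB fun x hx y hy => h₂ x (hX hx) y (hX' hy)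
  have i1 := frobSq_mul_le_right (cfc φ₁ (matAbs X) - cfc φ₁ (matAbs Xᴴ)) X
  have i2 := frobSq_mul_le_left X (cfc φ₂ (matAbs X) - cfc φ₂ (matAbs Xᴴ))
  have i3 := mul_le_mul_of_nonneg_right e1 (sq_nonneg ‖X‖)
  have i4 := mul_le_mul_of_nonneg_left e2 (sq_nonneg ‖X‖)
  refine (frobSq_sub_le _ _).trans ?_
  linarith

/-- `phi` is Lipschitz. -/
lemma exists_norm_phi_sub_le {K : ℝ} (hK : 0 ≤ K) {S : Set ℝ}
    (h₁ : ∀ x ∈ S, ∀ y ∈ S, |φ₁ x - φ₁ y| ≤ K * |x - y|)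
    (h₂ : ∀ x ∈ S, ∀ y ∈ S, |φ₂ x - φ₂ y| ≤ K * |x - y|) :
    ∃ L, 0 ≤ L ∧ ∀ X Y : Matrix (Fin n) (Fin n) ℂ,
      spectrum ℝ (matAbs X) ⊆ S → spectrum ℝ (matAbs Xᴴ) ⊆ S →
      spectrum ℝ (matAbs Y) ⊆ S → spectrum ℝ (matAbs Yᴴ) ⊆ S →
      ‖phi φ₁ φ₂ X - phi φ₁ φ₂ Y‖ ≤ L * ‖X - Y‖ := by
  refine ⟨2 * K * √n, by positivity, fun X Y hX hX' hY hY' => ?_⟩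
  refine abs_le_of_sq_le_sq' ?_ (by positivity) |>.2
  have e1 := frobSq_cfc_sub_le (isHermitian_matAbs X) (isHermitian_matAbs Y)
    fun x hx y hy => h₁ x (hX hx) y (hY hy)
  have e2 := frobSq_cfc_sub_le (isHermitian_matAbs Xᴴ) (isHermitian_matAbs Yᴴ)
    fun x hx y hy => h₂ x (hX' hx) y (hY' hy)
  have e3 := mul_le_mul_of_nonneg_left (frobSq_matAbs_sub_le X Y) (sq_nonneg K)
  have e4 := mul_le_mul_of_nonneg_left (frobSq_le_card_mul (X - Y)) (sq_nonneg K)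
  have e5 := frobSq_sub_le (cfc φ₁ (matAbs X) - cfc φ₁ (matAbs Y))
    (cfc φ₂ (matAbs Xᴴ) - cfc φ₂ (matAbs Yᴴ))
  have e6 : phi φ₁ φ₂ X - phi φ₁ φ₂ Y = (cfc φ₁ (matAbs X) - cfc φ₁ (matAbs Y)) -
      (cfc φ₂ (matAbs Xᴴ) - cfc φ₂ (matAbs Yᴴ)) := by
    rw [phi, phi]; abel
  refine (norm_sq_le_frobSq _).trans ?_
  rw [e6, mul_pow, mul_pow, mul_pow, Real.sq_sqrt (by positivity)]
  rw [Fintype.card_fin] at e4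
  linarith

lemma norm_lie_sub_lie_le (A B X Y : Matrix (Fin n) (Fin n) ℂ) :
    ‖⁅A, X⁆ - ⁅B, Y⁆‖ ≤ 2 * (‖A - B‖ * ‖X‖ + ‖B‖ * ‖X - Y‖) := by
  have h : ⁅A, X⁆ - ⁅B, Y⁆ = ((A - B) * X + B * (X - Y)) - (X * (A - B) + (X - Y) * B) := by
    simp only [Ring.lie_def]
    noncomm_ring
  rw [h]
  refine (norm_sub_le _ _).trans ?_
  have h1 := norm_add_le ((A - B) * X) (B * (X - Y))
  have h2 := norm_add_le (X * (A - B)) ((X - Y) * B)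
  have h3 := norm_mul_le (A - B) X
  have h4 := norm_mul_le B (X - Y)
  have h5 := norm_mul_le X (A - B)
  have h6 := norm_mul_le (X - Y) B
  linarith

open Filter Topology in
/-- Euler steps of the flow do not increase the operator norm. -/
lemma eventually_norm_add_smul_lie_le {X : Matrix (Fin n) (Fin n) ℂ} {S : Set ℝ}
    (h₁ : MonotoneOn φ₁ S) (h₂ : MonotoneOn φ₂ S) (hX : spectrum ℝ (matAbs X) ⊆ S)
    (hX' : spectrum ℝ (matAbs Xᴴ) ⊆ S) (hs : ‖X‖ ∈ S) :
    ∀ᶠ h : ℝ in 𝓝[≥] 0, ‖X + h • ⁅phi φ₁ φ₂ X, X⁆‖ ≤ ‖X‖ := by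
  have hA := isHermitian_matAbs X
  have hB := isHermitian_matAbs Xᴴ
  have hfA := Matrix.finite_real_spectrum (A := matAbs X)
  have hfB := Matrix.finite_real_spectrum (A := matAbs Xᴴ)
  set s := ‖X‖ with hsdef
  have hs0 : 0 ≤ s := norm_nonneg X
  -- Subtracting constants from `φ₁` and `φ₂` changes `φ(X)` by a scalar and leaves the commutator
  -- alone, so both functions may be taken nonnegative at the relevant points.
  obtain ⟨c₁, hc₁⟩ := ((hfA.insert s).image φ₁).bddBelow
  obtain ⟨c₂, hc₂⟩ := (((hfA.union hfB).insert s).image φ₂).bddBelow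
  set f₁ : ℝ → ℝ := fun x => φ₁ x - c₁ with hf₁
  set f₂ : ℝ → ℝ := fun x => φ₂ x - c₂ with hf₂
  have cs : ∀ (A : Matrix (Fin n) (Fin n) ℂ) (hA : A.IsHermitian) (φ : ℝ → ℝ) (c : ℝ),
      cfc (fun x => φ x - c) A = cfc φ A - algebraMap ℝ _ c := fun A hA φ c => by
    rw [cfc_sub φ (fun _ => c) A (continuousOn_spectrum _ _) (continuousOn_spectrum _ _)]
    congr 1
    exact cfc_const c A hA
  have hV : ∀ h : ℝ, X + h • ⁅phi φ₁ φ₂ X, X⁆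
      = X * cfc (fun x => 1 - h * (f₁ x + f₂ x)) (matAbs X)
        + h • (cfc f₁ (matAbs X) * X + X * cfc f₂ (matAbs Xᴴ)) := by
    intro h
    have e1 : cfc (fun x => 1 - h * (f₁ x + f₂ x)) (matAbs X)
        = 1 - h • (cfc f₁ (matAbs X) + cfc f₂ (matAbs X)) := by
      rw [cfc_sub (fun _ => 1) (fun x => h * (f₁ x + f₂ x)) _ (continuousOn_spectrum _ _)
        (continuousOn_spectrum _ _), cfc_one_eq hA, cfc_const_mul h (fun x => f₁ x + f₂ x) _
        (continuousOn_spectrum _ _), cfc_add _ f₁ f₂ (continuousOn_spectrum _ _)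
        (continuousOn_spectrum _ _)]
    have e2 : ⁅phi φ₁ φ₂ X, X⁆ = cfc f₁ (matAbs X) * X + X * cfc f₂ (matAbs Xᴴ)
        - X * (cfc f₁ (matAbs X) + cfc f₂ (matAbs X)) := by
      rw [mul_add, mul_cfc_matAbs X f₂, hf₁, hf₂, cs _ hA, cs _ hB, Ring.lie_def, phi]
      simp only [sub_mul, mul_sub, ← Algebra.commutes _ X]
      abel
    rw [e1, e2, mul_sub, mul_one, mul_smul_comm, smul_sub]
    abel
  have n1 : ‖cfc f₁ (matAbs X)‖ ≤ f₁ s := by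
    refine norm_cfc_le ?_ fun x hx => ?_
    · exact sub_nonneg.2 (hc₁ ⟨s, Or.inl rfl, rfl⟩)
    · rw [Real.norm_eq_abs, abs_of_nonneg (sub_nonneg.2 (hc₁ ⟨x, Or.inr hx, rfl⟩))]
      exact sub_le_sub_right (h₁ (hX hx) hs (le_norm_of_mem_spectrum_matAbs hx)) _
  have n2 : ‖cfc f₂ (matAbs Xᴴ)‖ ≤ f₂ s := by
    refine norm_cfc_le ?_ fun x hx => ?_
    · exact sub_nonneg.2 (hc₂ ⟨s, Or.inl rfl, rfl⟩)
    · rw [Real.norm_eq_abs, abs_of_nonneg (sub_nonneg.2 (hc₂ ⟨x, Or.inr (Or.inr hx), rfl⟩))]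
      refine sub_le_sub_right (h₂ (hX' hx) hs ?_) _
      rw [hsdef, ← Matrix.l2_opNorm_conjTranspose]
      exact le_norm_of_mem_spectrum_matAbs hx
  have small : ∀ r : ℝ, ∀ᶠ h : ℝ in 𝓝[≥] 0, 0 ≤ 1 - h * r := fun r => by
    refine eventually_nhdsWithin_of_eventually_nhds ?_
    have ht : Tendsto (fun h : ℝ => 1 - h * r) (𝓝 0) (𝓝 (1 - 0 * r)) :=
      Continuous.tendsto (by fun_prop) 0
    exact (ht.eventually (lt_mem_nhds (by norm_num : (0 : ℝ) < 1 - 0 * r))).mono fun _ => le_of_lt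
  -- For `x < s` the inequality is strict at `h = 0` and so persists for small `h`; for `x = s` it
  -- is an equality. Finiteness of the spectrum gives a common range of `h`.
  have hmain : ∀ᶠ h : ℝ in 𝓝[≥] 0, ∀ x ∈ spectrum ℝ (matAbs X),
      |x * (1 - h * (f₁ x + f₂ x))| ≤ s * (1 - h * (f₁ s + f₂ s)) := by
    rw [hfA.eventually_all]
    intro x hx
    have hx0 := nonneg_of_mem_spectrum_matAbs hx
    have hxs : x ≤ s := le_norm_of_mem_spectrum_matAbs hx
    have hlt : ∀ᶠ h : ℝ in 𝓝[≥] 0,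
        x * (1 - h * (f₁ x + f₂ x)) ≤ s * (1 - h * (f₁ s + f₂ s)) := by
      rcases hxs.eq_or_lt with rfl | hlt
      · exact Eventually.of_forall fun _ => le_rfl
      · refine eventually_nhdsWithin_of_eventually_nhds ?_
        have c1 : Tendsto (fun h : ℝ => x * (1 - h * (f₁ x + f₂ x))) (𝓝 0)
            (𝓝 (x * (1 - 0 * (f₁ x + f₂ x)))) := Continuous.tendsto (by fun_prop) 0
        have c2 : Tendsto (fun h : ℝ => s * (1 - h * (f₁ s + f₂ s))) (𝓝 0)
            (𝓝 (s * (1 - 0 * (f₁ s + f₂ s)))) := Continuous.tendsto (by fun_prop) 0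
        exact (c1.eventually_lt c2 (by simpa using hlt)).mono fun _ => le_of_lt
    filter_upwards [hlt, small (f₁ x + f₂ x)] with h h1 h2
    rwa [abs_of_nonneg (mul_nonneg hx0 h2)]
  filter_upwards [hmain, small (f₁ s + f₂ s), self_mem_nhdsWithin] with h h1 h2 h3
  have h3 : 0 ≤ h := h3
  rw [hV]
  calc _ ≤ ‖X * cfc (fun x => 1 - h * (f₁ x + f₂ x)) (matAbs X)‖
        + ‖h • (cfc f₁ (matAbs X) * X + X * cfc f₂ (matAbs Xᴴ))‖ := norm_add_le _ _
    _ ≤ s * (1 - h * (f₁ s + f₂ s)) + h * (f₁ s * s + s * f₂ s) := by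
        refine add_le_add (norm_mul_cfc_matAbs_le (mul_nonneg hs0 h2) h1) ?_
        rw [norm_smul, Real.norm_eq_abs, abs_of_nonneg h3]
        refine mul_le_mul_of_nonneg_left ((norm_add_le _ _).trans (add_le_add ?_ ?_)) h3
        · exact (norm_mul_le _ _).trans (by gcongr)
        · exact (norm_mul_le _ _).trans (by gcongr)
    _ = s := by ring

end VectorField

/-! ### Global existence for fields with norm-nonincreasing Euler steps. -/

section Flow

open Filter Topology Set


variable {E : Type*} [NormedAddCommGroup E]

/-- A radial cutoff. -/
noncomputable def radialCutoff (R : ℝ) (x : E) : ℝ := max 0 (min 1 (R + 1 - ‖x‖))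

lemma radialCutoff_nonneg (R : ℝ) (x : E) : 0 ≤ radialCutoff R x := le_max_left _ _

lemma radialCutoff_le_one (R : ℝ) (x : E) : radialCutoff R x ≤ 1 :=
  max_le zero_le_one (min_le_left _ _)

lemma radialCutoff_eq_one {R : ℝ} {x : E} (h : ‖x‖ ≤ R) : radialCutoff R x = 1 := by
  rw [radialCutoff, min_eq_left (by linarith), max_eq_right zero_le_one]

lemma radialCutoff_eq_zero {R : ℝ} {x : E} (h : R + 1 ≤ ‖x‖) : radialCutoff R x = 0 := by
  rw [radialCutoff, min_eq_right (by linarith), max_eq_left (by linarith)]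

lemma abs_radialCutoff_sub_le (R : ℝ) (x y : E) :
    |radialCutoff R x - radialCutoff R y| ≤ ‖x - y‖ := by
  unfold radialCutoff
  refine (abs_max_sub_max_le_max _ _ _ _).trans (max_le (by simp) ?_)
  refine (abs_min_sub_min_le_max _ _ _ _).trans (max_le (by simp) ?_)
  rw [show R + 1 - ‖x‖ - (R + 1 - ‖y‖) = ‖y‖ - ‖x‖ by ring, norm_sub_rev]
  exact abs_norm_sub_norm_le _ _

lemma tendsto_sub_nhdsGT (t : ℝ) : Tendsto (fun z : ℝ => z - t) (𝓝[>] t) (𝓝[≥] 0) := by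
  refine tendsto_nhdsWithin_iff.2 ⟨?_, ?_⟩
  · have : Tendsto (fun z : ℝ => z - t) (𝓝 t) (𝓝 (t - t)) := Continuous.tendsto (by fun_prop) t
    rw [sub_self] at this
    exact this.mono_left nhdsWithin_le_nhds
  · filter_upwards [self_mem_nhdsWithin] with z hz
    exact sub_nonneg.2 (le_of_lt (mem_Ioi.1 hz))

variable [NormedSpace ℝ E]

/-- If infinitesimal Euler steps do not increase the norm, the norm is nonincreasing. -/
lemma norm_le_of_eventually_norm_add_smul_le {X v : ℝ → E} {T : ℝ}
    (hc : ContinuousOn X (Icc 0 T)) (hd : ∀ t ∈ Ico 0 T, HasDerivWithinAt X (v t) (Ici t) t)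
    (hs : ∀ t ∈ Ico 0 T, ∀ᶠ h : ℝ in 𝓝[≥] 0, ‖X t + h • v t‖ ≤ ‖X t‖) :
    ∀ t ∈ Icc 0 T, ‖X t‖ ≤ ‖X 0‖ := by
  intro t ht
  refine image_le_of_liminf_slope_right_le_deriv_boundary (f := fun t => ‖X t‖)
    (B := fun _ => ‖X 0‖) (B' := fun _ => 0) hc.norm le_rfl continuousOn_const
    (fun x _ => hasDerivWithinAt_const _ _ _) ?_ ht
  intro x hx r hr
  refine Eventually.frequently ?_
  have h1 := hasDerivWithinAt_iff_tendsto_slope.1 (hd x hx)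
  rw [Ici_sdiff_left] at h1
  have h2 : Tendsto (fun z => ‖slope X x z - v x‖) (𝓝[>] x) (𝓝 0) := by
    have := (h1.sub_const (v x)).norm
    simpa using this
  filter_upwards [h2.eventually (gt_mem_nhds hr), (tendsto_sub_nhdsGT x).eventually (hs x hx),
    self_mem_nhdsWithin] with z h3 h4 h5
  have h5 : 0 < z - x := sub_pos.2 h5
  have h6 : X z = (X x + (z - x) • v x) + (z - x) • (slope X x z - v x) := by
    rw [smul_sub, sub_smul_slope, vsub_eq_sub]
    abel
  have h7 : ‖X z‖ ≤ ‖X x‖ + (z - x) * ‖slope X x z - v x‖ := by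
    calc ‖X z‖ ≤ ‖X x + (z - x) • v x‖ + ‖(z - x) • (slope X x z - v x)‖ := by
          rw [h6]; exact norm_add_le _ _
      _ ≤ _ := by
          rw [norm_smul, Real.norm_eq_abs, abs_of_pos h5]
          gcongr
  rw [slope_def_field, div_lt_iff₀ h5]
  nlinarith

lemma exists_solution_Icc [CompleteSpace E] {V : E → E}
    (hV : ∀ R : ℝ, ∃ K : ℝ, 0 ≤ K ∧ ∀ x y : E, ‖x‖ ≤ R → ‖y‖ ≤ R → ‖V x - V y‖ ≤ K * ‖x - y‖)
    (hs : ∀ x : E, ∀ᶠ h : ℝ in 𝓝[≥] 0, ‖x + h • V x‖ ≤ ‖x‖) (x₀ : E) {T : ℝ} (hT : 0 < T) :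
    ∃ X : ℝ → E, X 0 = x₀ ∧ (∀ t ∈ Icc 0 T, ‖X t‖ ≤ ‖x₀‖) ∧
      ∀ t ∈ Icc 0 T, HasDerivWithinAt X (V (X t)) (Icc 0 T) t := by
  set R := ‖x₀‖
  have hR : 0 ≤ R := norm_nonneg x₀
  -- The cutoff makes the field globally bounded by `L`, so one Picard–Lindelöf ball of radius `L *
  -- T` serves all of `[0, T]`.
  set W : E → E := fun x => radialCutoff R x • V x with hW
  have bound : ∀ ρ : ℝ, ∃ B : ℝ, 0 ≤ B ∧ ∀ x : E, ‖x‖ ≤ ρ → ‖V x‖ ≤ B := by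
    intro ρ
    obtain ⟨K, hK0, hK⟩ := hV (max ρ 0)
    refine ⟨K * max ρ 0 + ‖V 0‖, by positivity, fun x hx => ?_⟩
    have h1 := hK x 0 (hx.trans (le_max_left _ _)) (by simp)
    rw [sub_zero] at h1
    have h2 : K * ‖x‖ ≤ K * max ρ 0 :=
      mul_le_mul_of_nonneg_left (hx.trans (le_max_left _ _)) hK0
    have h3 := norm_sub_norm_le (V x) (V 0)
    linarith
  obtain ⟨L, hL0, hL⟩ := bound (R + 1)
  have hWL : ∀ x, ‖W x‖ ≤ L := by
    intro x
    rcases le_total ‖x‖ (R + 1) with h | h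
    · rw [hW, norm_smul, Real.norm_eq_abs, abs_of_nonneg (radialCutoff_nonneg _ _)]
      calc _ ≤ 1 * L := mul_le_mul (radialCutoff_le_one _ _) (hL x h) (norm_nonneg _) zero_le_one
        _ = L := one_mul _
    · simpa [hW, radialCutoff_eq_zero h] using hL0
  set a := L * T with ha
  have ha0 : 0 ≤ a := by positivity
  obtain ⟨K, hK0, hK⟩ := hV (R + a)
  obtain ⟨B, hB0, hB⟩ := bound (R + a)
  have hmem : ∀ x ∈ Metric.closedBall x₀ a, ‖x‖ ≤ R + a := by
    intro x hx
    rw [mem_closedBall_iff_norm] at hx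
    have := norm_le_norm_add_norm_sub' x x₀
    linarith
  have hlip : ∀ x ∈ Metric.closedBall x₀ a, ∀ y ∈ Metric.closedBall x₀ a,
      ‖W x - W y‖ ≤ (B + K) * ‖x - y‖ := by
    intro x hx y hy
    have e : W x - W y = (radialCutoff R x - radialCutoff R y) • V x
        + radialCutoff R y • (V x - V y) := by
      rw [hW, sub_smul, smul_sub]; abel
    rw [e]
    refine (norm_add_le _ _).trans ?_
    rw [norm_smul, norm_smul, Real.norm_eq_abs, Real.norm_eq_abs,
      abs_of_nonneg (radialCutoff_nonneg R y)]
    have h1 := mul_le_mul (abs_radialCutoff_sub_le R x y) (hB x (hmem x hx)) (norm_nonneg _)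
      (norm_nonneg _)
    have h2 := mul_le_mul (radialCutoff_le_one R y) (hK x y (hmem x hx) (hmem y hy))
      (norm_nonneg _) zero_le_one
    linarith
  have hPL : IsPicardLindelof (fun _ : ℝ => W) (⟨0, left_mem_Icc.2 hT.le⟩ : Icc (0 : ℝ) T) x₀
      ⟨a, ha0⟩ 0 ⟨L, hL0⟩ ⟨B + K, by positivity⟩ :=
    { lipschitzOnWith := fun t _ => LipschitzOnWith.of_dist_le_mul fun x hx y hy => by
        rw [dist_eq_norm, dist_eq_norm]
        exact hlip x hx y hy
      continuousOn := fun x _ => continuousOn_const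
      norm_le := fun t _ x _ => hWL x
      mul_max_le := by
        simp only [sub_zero, sub_self, max_eq_left hT.le, NNReal.coe_zero]
        exact le_rfl }
  obtain ⟨X, hX0, hX⟩ := hPL.exists_eq_forall_mem_Icc_hasDerivWithinAt (x := x₀)
    (Metric.mem_closedBall_self (by simp))
  have hX0 : X 0 = x₀ := hX0
  have hnorm : ∀ t ∈ Icc 0 T, ‖X t‖ ≤ R := by
    have := norm_le_of_eventually_norm_add_smul_le (X := X) (v := fun t => W (X t)) (T := T)
      (fun t ht => (hX t ht).continuousWithinAt)
      (fun t ht => (hX t ⟨ht.1, ht.2.le⟩).mono_of_mem_nhdsWithin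
        (mem_of_superset (Icc_mem_nhdsGE ht.2) (Icc_subset_Icc_left ht.1))) ?_
    · rwa [hX0] at this
    · intro t _
      -- An Euler step of `W` of size `h` is an Euler step of `V` of size `h` times the cutoff. The
      -- norm thus stays at most `R`, where the cutoff is `1`.
      have ht : Tendsto (fun h : ℝ => h * radialCutoff R (X t)) (𝓝[≥] 0) (𝓝[≥] 0) := by
        refine tendsto_nhdsWithin_iff.2 ⟨?_, ?_⟩
        · have : Tendsto (fun h : ℝ => h * radialCutoff R (X t)) (𝓝 0)
            (𝓝 (0 * radialCutoff R (X t))) := Continuous.tendsto (by fun_prop) 0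
          rw [zero_mul] at this
          exact this.mono_left nhdsWithin_le_nhds
        · filter_upwards [self_mem_nhdsWithin] with h hh
          exact mul_nonneg hh (radialCutoff_nonneg _ _)
      filter_upwards [ht.eventually (hs (X t))] with h hh
      rwa [hW, smul_smul]
  refine ⟨X, hX0, hnorm, fun t ht => ?_⟩
  have := hX t ht
  simp only [hW, radialCutoff_eq_one (hnorm t ht), one_smul] at this
  exact this

/-- Global existence for a locally Lipschitz field whose Euler steps do not increase the norm. -/
theorem exists_global_solution [CompleteSpace E] {V : E → E}
    (hV : ∀ R : ℝ, ∃ K : ℝ, 0 ≤ K ∧ ∀ x y : E, ‖x‖ ≤ R → ‖y‖ ≤ R → ‖V x - V y‖ ≤ K * ‖x - y‖)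
    (hs : ∀ x : E, ∀ᶠ h : ℝ in 𝓝[≥] 0, ‖x + h • V x‖ ≤ ‖x‖) (x₀ : E) :
    ∃ X : ℝ → E, X 0 = x₀ ∧ (∀ t, 0 ≤ t → ‖X t‖ ≤ ‖x₀‖) ∧
      ∀ t, 0 ≤ t → HasDerivWithinAt X (V (X t)) (Ici 0) t := by
  have h := fun T (hT : (0 : ℝ) < T) => exists_solution_Icc hV hs x₀ hT
  choose! Z hZ0 hZn hZd using h
  obtain ⟨K, hK0, hK⟩ := hV ‖x₀‖
  have huniq : ∀ S T : ℝ, 0 < S → S ≤ T → EqOn (Z S) (Z T) (Icc 0 S) := by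
    intro S T hS hST
    have hT := hS.trans_le hST
    refine ODE_solution_unique_of_mem_Icc_right (v := fun _ => V) (K := ⟨K, hK0⟩)
      (s := fun _ => Metric.closedBall 0 ‖x₀‖) ?_ ?_ ?_ ?_ ?_ ?_ ?_ ?_
    · intro t _
      refine LipschitzOnWith.of_dist_le_mul fun x hx y hy => ?_
      rw [dist_eq_norm, dist_eq_norm]
      exact hK x y (by simpa using hx) (by simpa using hy)
    · exact fun t ht => (hZd S hS t ht).continuousWithinAt
    · exact fun t ht => (hZd S hS t ⟨ht.1, ht.2.le⟩).mono_of_mem_nhdsWithin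
        (mem_of_superset (Icc_mem_nhdsGE ht.2) (Icc_subset_Icc_left ht.1))
    · exact fun t ht => by simpa using hZn S hS t ⟨ht.1, ht.2.le⟩
    · exact fun t ht => ((hZd T hT t ⟨ht.1, ht.2.trans hST⟩).continuousWithinAt).mono
        (Icc_subset_Icc_right hST)
    · exact fun t ht => (hZd T hT t ⟨ht.1, ht.2.le.trans hST⟩).mono_of_mem_nhdsWithin
        (mem_of_superset (Icc_mem_nhdsGE (ht.2.trans_le hST)) (Icc_subset_Icc_left ht.1))
    · exact fun t ht => by simpa using hZn T hT t ⟨ht.1, ht.2.le.trans hST⟩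
    · rw [hZ0 S hS, hZ0 T hT]
  -- The horizon exceeds the time by `1`, so near `t` the glued curve agrees with the single
  -- solution on `[0, t + 2]`.
  refine ⟨fun t => Z (t + 1) t, hZ0 _ (by norm_num), fun t ht =>
    hZn _ (by linarith) t ⟨ht, by linarith⟩, fun t ht => ?_⟩
  have heq : ∀ s ∈ Ico 0 (t + 1), Z (s + 1) s = Z (t + 2) s := fun s hs' =>
    huniq _ _ (by linarith [hs'.1]) (by linarith [hs'.2]) ⟨hs'.1, by linarith⟩
  have hmem : Ico 0 (t + 1) ∈ 𝓝[Ici 0] t := by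
    refine mem_nhdsWithin.2 ⟨Iio (t + 1), isOpen_Iio, by simp, fun s hs' => ⟨hs'.2, hs'.1⟩⟩
  have hd : HasDerivWithinAt (Z (t + 2)) (V (Z (t + 2) t)) (Ici 0) t :=
    (hZd (t + 2) (by linarith) t ⟨ht, by linarith⟩).mono_of_mem_nhdsWithin
      (mem_of_superset hmem fun s hs' => ⟨hs'.1, by linarith [hs'.2]⟩)
  have ht1 : t ∈ Ico 0 (t + 1) := ⟨ht, by linarith⟩
  show HasDerivWithinAt (fun t => Z (t + 1) t) (V (Z (t + 1) t)) (Ici 0) t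
  rw [heq t ht1]
  exact hd.congr_of_eventuallyEq (mem_of_superset hmem heq) (heq t ht1)

end Flow

/-! ### Spectral idempotents and the quadratic bound on the departure from normality. -/

section PolynomialCalculus

open Polynomial

variable {n : ℕ}

lemma exists_norm_aeval_le (p : ℂ[X]) (R : ℝ) : ∃ M, 0 ≤ M ∧
    ∀ X : Matrix (Fin n) (Fin n) ℂ, ‖X‖ ≤ R → ‖aeval X p‖ ≤ M := by
  induction p using Polynomial.induction_on' with
  | add p q hp hq =>
    obtain ⟨M, hM0, hM⟩ := hp
    obtain ⟨M', hM'0, hM'⟩ := hq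
    refine ⟨M + M', by positivity, fun X hX => ?_⟩
    rw [map_add]
    exact (norm_add_le _ _).trans (add_le_add (hM X hX) (hM' X hX))
  | monomial k c =>
    simp only [aeval_monomial, ← Algebra.smul_def, norm_smul]
    suffices h : ∃ M, 0 ≤ M ∧ ∀ X : Matrix (Fin n) (Fin n) ℂ, ‖X‖ ≤ R → ‖X ^ k‖ ≤ M by
      obtain ⟨M, hM0, hM⟩ := h
      exact ⟨‖c‖ * M, by positivity, fun X hX =>
        mul_le_mul_of_nonneg_left (hM X hX) (norm_nonneg c)⟩
    induction k with
    | zero => exact ⟨‖(1 : Matrix (Fin n) (Fin n) ℂ)‖, norm_nonneg _, fun X _ => by simp⟩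
    | succ k ih =>
      obtain ⟨M, hM0, hM⟩ := ih
      refine ⟨M * |R|, by positivity, fun X hX => ?_⟩
      rw [pow_succ]
      exact (norm_mul_le _ _).trans (mul_le_mul (hM X hX) (hX.trans (le_abs_self R))
        (norm_nonneg _) hM0)

/-- Commutators with polynomials in `X` are dominated by commutators with `X`. -/
lemma exists_norm_lie_aeval_le (p : ℂ[X]) (R : ℝ) : ∃ C, 0 ≤ C ∧
    ∀ X Y : Matrix (Fin n) (Fin n) ℂ, ‖X‖ ≤ R → ‖⁅aeval X p, Y⁆‖ ≤ C * ‖⁅X, Y⁆‖ := by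
  induction p using Polynomial.induction_on' with
  | add p q hp hq =>
    obtain ⟨M, hM0, hM⟩ := hp
    obtain ⟨M', hM'0, hM'⟩ := hq
    refine ⟨M + M', by positivity, fun X Y hX => ?_⟩
    have e : ⁅aeval X p + aeval X q, Y⁆ = ⁅aeval X p, Y⁆ + ⁅aeval X q, Y⁆ := by
      simp only [Ring.lie_def]
      noncomm_ring
    rw [map_add, e, add_mul]
    exact (norm_add_le _ _).trans (add_le_add (hM X Y hX) (hM' X Y hX))
  | monomial k c =>
    simp only [aeval_monomial, ← Algebra.smul_def]
    suffices h : ∃ M, 0 ≤ M ∧ ∀ X Y : Matrix (Fin n) (Fin n) ℂ, ‖X‖ ≤ R →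
        ‖⁅X ^ k, Y⁆‖ ≤ M * ‖⁅X, Y⁆‖ by
      obtain ⟨M, hM0, hM⟩ := h
      refine ⟨‖c‖ * M, by positivity, fun X Y hX => ?_⟩
      rw [Ring.lie_def, smul_mul_assoc, mul_smul_comm, ← smul_sub, ← Ring.lie_def, norm_smul,
        mul_assoc]
      exact mul_le_mul_of_nonneg_left (hM X Y hX) (norm_nonneg c)
    induction k with
    | zero => exact ⟨0, le_rfl, fun X Y _ => by simp [Ring.lie_def]⟩
    | succ k ih =>
      obtain ⟨M, hM0, hM⟩ := ih
      obtain ⟨B, hB0, hB⟩ := exists_norm_aeval_le (n := n) (X ^ k : ℂ[X]) R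
      refine ⟨B + M * |R|, by positivity, fun X Y hX => ?_⟩
      have h1 : ⁅X ^ (k + 1), Y⁆ = X ^ k * ⁅X, Y⁆ + ⁅X ^ k, Y⁆ * X := by
        simp only [Ring.lie_def, pow_succ]
        noncomm_ring
      have h2 : ‖X ^ k‖ ≤ B := by simpa using hB X hX
      rw [h1, add_mul]
      refine (norm_add_le _ _).trans (add_le_add ?_ ?_)
      · exact (norm_mul_le _ _).trans (by gcongr)
      · calc ‖⁅X ^ k, Y⁆ * X‖ ≤ ‖⁅X ^ k, Y⁆‖ * ‖X‖ := norm_mul_le _ _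
          _ ≤ (M * ‖⁅X, Y⁆‖) * |R| :=
            mul_le_mul (hM X Y hX) (hX.trans (le_abs_self R)) (norm_nonneg _) (by positivity)
          _ = _ := by ring

/-- Polynomials vanishing on `s` annihilate `X`: `X` is diagonalizable with spectrum in `s`. -/
def IsAnnihilatedOn (s : Finset ℂ) (X : Matrix (Fin n) (Fin n) ℂ) : Prop :=
  ∀ p : ℂ[X], (∀ x ∈ s, p.eval x = 0) → aeval X p = 0

lemma IsAnnihilatedOn.aeval_congr {s : Finset ℂ} {X : Matrix (Fin n) (Fin n) ℂ}
    (h : IsAnnihilatedOn s X) {p q : ℂ[X]} (hpq : ∀ x ∈ s, p.eval x = q.eval x) :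
    aeval X p = aeval X q := by
  have := h (p - q) fun x hx => by rw [eval_sub, hpq x hx, sub_self]
  rwa [map_sub, sub_eq_zero] at this

lemma eval_interpolate_id {s : Finset ℂ} (r : ℂ → ℂ) {x : ℂ} (hx : x ∈ s) :
    (Lagrange.interpolate s id r).eval x = r x :=
  Lagrange.eval_interpolate_at_node r (Set.injOn_id _) hx

/-- The spectral idempotent of `X` at `x`. -/
noncomputable def spectralIdempotent (s : Finset ℂ) (X : Matrix (Fin n) (Fin n) ℂ) (x : ℂ) :
    Matrix (Fin n) (Fin n) ℂ :=
  aeval X (Lagrange.interpolate s id fun y => if y = x then 1 else 0)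

variable {s : Finset ℂ} {X : Matrix (Fin n) (Fin n) ℂ}

lemma IsAnnihilatedOn.idempotent_mul (h : IsAnnihilatedOn s X) (x y : ℂ) :
    spectralIdempotent s X x * spectralIdempotent s X y =
      if x = y then spectralIdempotent s X x else 0 := by
  rw [spectralIdempotent, spectralIdempotent, ← map_mul]
  split_ifs with hxy
  · subst hxy
    refine h.aeval_congr fun z hz => ?_
    rw [eval_mul, eval_interpolate_id _ hz]
    split_ifs <;> simp
  · refine h _ fun z hz => ?_
    rw [eval_mul, eval_interpolate_id _ hz, eval_interpolate_id _ hz]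
    by_cases h1 : z = x
    · have : z ≠ y := fun h2 => hxy (h1.symm.trans h2)
      simp [this]
    · simp [h1]

lemma IsAnnihilatedOn.aeval_interpolate (h : IsAnnihilatedOn s X) (r : ℂ → ℂ) :
    aeval X (Lagrange.interpolate s id r) = ∑ x ∈ s, r x • spectralIdempotent s X x := by
  have : ∑ x ∈ s, r x • spectralIdempotent s X x = aeval X (∑ x ∈ s, r x •
      Lagrange.interpolate s id fun y => if y = x then (1 : ℂ) else 0) := by
    simp only [map_sum, map_smul, spectralIdempotent]
  rw [this]
  refine h.aeval_congr fun z hz => ?_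
  simp only [eval_finsetSum, eval_smul, eval_interpolate_id _ hz]
  simp [hz]

lemma IsAnnihilatedOn.eq_sum (h : IsAnnihilatedOn s X) :
    X = ∑ x ∈ s, x • spectralIdempotent s X x := by
  rw [← h.aeval_interpolate fun x => x]
  conv_lhs => rw [← aeval_X (R := ℂ) X]
  exact h.aeval_congr fun z hz => by rw [eval_X, eval_interpolate_id _ hz]

/-- The convention `0⁻¹ = 0` makes `x * x⁻¹ * x = x` hold at zero too, so singular `X` is covered.
The generalized inverse is a polynomial in `X`, hence bounded when `X` is. -/
lemma IsAnnihilatedOn.mul_generalized_inverse_mul (h : IsAnnihilatedOn s X) :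
    X * aeval X (Lagrange.interpolate s id fun x => x⁻¹) * X = X := by
  have h1 : aeval X ((Polynomial.X : ℂ[X]) * Lagrange.interpolate s id (fun x => x⁻¹) *
      Polynomial.X) = aeval X (Polynomial.X : ℂ[X]) := h.aeval_congr fun z hz => by
    rw [eval_mul, eval_mul, eval_X, eval_interpolate_id _ hz]
    by_cases hz0 : z = 0
    · simp [hz0]
    · field_simp
  simpa using h1

/-- The distance of an idempotent from its adjoint is dominated by their commutator. -/
lemma frobSq_conjTranspose_sub_le {P : Matrix (Fin n) (Fin n) ℂ} (hP : P * P = P) :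
    frobSq (Pᴴ - P) ≤ 2 * frobSq ⁅P, Pᴴ⁆ := by
  have hP' : Pᴴ * Pᴴ = Pᴴ := by rw [← Matrix.conjTranspose_mul, hP]
  set Q := Pᴴ with hQ
  have hQP : Qᴴ = P := Matrix.conjTranspose_conjTranspose P
  have hY : (P - P * Q)ᴴ = Q - P * Q := by
    rw [Matrix.conjTranspose_sub, Matrix.conjTranspose_mul, hQP]
  -- `PP*` is Hermitian, so it drops out when `P - PP*` is subtracted from its adjoint.
  have h1 : frobSq (Q - P) ≤ 4 * frobSq (P - P * Q) := by
    have e : Q - P = (P - P * Q)ᴴ - (P - P * Q) := by rw [hY]; abel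
    rw [e]
    refine (frobSq_sub_le _ _).trans ?_
    rw [frobSq_conjTranspose]
    linarith
  have h2 : frobSq ⁅P, Q⁆ = 2 * frobSq (P - P * Q) := by
    have e1 := trace_mul_conjTranspose_self (P - P * Q)
    have e2 := trace_mul_conjTranspose_self ⁅P, Q⁆
    have e3 : (⁅P, Q⁆)ᴴ = ⁅P, Q⁆ := by
      rw [Ring.lie_def, Matrix.conjTranspose_sub, Matrix.conjTranspose_mul,
        Matrix.conjTranspose_mul, hQP]
    have t1 : (P - P * Q) * (Q - P * Q) = P * Q * P * Q - P * Q * Q - P * (P * Q) + P * Q := by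
      noncomm_ring
    have t2 : ⁅P, Q⁆ * ⁅P, Q⁆ = P * Q * P * Q - P * (Q * Q) * P - Q * (P * P) * Q
        + Q * P * Q * P := by
      rw [Ring.lie_def]
      noncomm_ring
    have c1 : (P * Q * P).trace = (P * Q).trace := by
      rw [Matrix.trace_mul_comm, ← mul_assoc, hP]
    have c2 : (Q * P * Q).trace = (P * Q).trace := by
      rw [Matrix.trace_mul_comm, ← mul_assoc, hP', Matrix.trace_mul_comm]
    have c3 : (Q * P * Q * P).trace = (P * Q * P * Q).trace := by
      rw [mul_assoc Q, mul_assoc Q, Matrix.trace_mul_comm]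
    rw [hY, t1] at e1
    rw [e3, t2, hP, hP'] at e2
    simp only [Matrix.trace_add, Matrix.trace_sub, c1, c2, c3] at e2
    rw [mul_assoc (P) Q Q, hP', ← mul_assoc P P Q, hP] at e1
    simp only [Matrix.trace_add, Matrix.trace_sub] at e1
    have e4 : (frobSq ⁅P, Q⁆ : ℂ) = 2 * frobSq (P - P * Q) := by
      rw [← e1, ← e2]; ring
    exact_mod_cast e4
  linarith

/-- An apparently first-order term in `P* - P` is in fact second-order: expanding the right side,
all terms containing `EP` or `PE` vanish. This cancellation, with `trace_mul_sub_self` for `E = P`,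
makes the departure from normality quadratic. -/
lemma trace_mul_sub_of_mul_eq_zero {P E : Matrix (Fin n) (Fin n) ℂ} (hP : P * P = P)
    (h1 : P * E = 0) (h2 : E * P = 0) :
    (E * (Pᴴ - P)).trace = ((Pᴴ - P) * E * (Pᴴ - P)).trace := by
  have hP' : Pᴴ * Pᴴ = Pᴴ := by rw [← Matrix.conjTranspose_mul, hP]
  rw [mul_sub, sub_mul, h1, sub_zero, mul_sub, mul_assoc _ E P, h2, mul_zero, sub_zero, sub_zero,
    Matrix.trace_mul_comm, Matrix.trace_mul_comm (Pᴴ * E), ← mul_assoc, hP']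

lemma trace_mul_sub_self {P : Matrix (Fin n) (Fin n) ℂ} (hP : P * P = P) :
    (P * (Pᴴ - P)).trace = -((Pᴴ - P) * P * (Pᴴ - P)).trace := by
  have hP' : Pᴴ * Pᴴ = Pᴴ := by rw [← Matrix.conjTranspose_mul, hP]
  have e : (Pᴴ - P) * P * (Pᴴ - P) = Pᴴ * P * Pᴴ - Pᴴ * (P * P) - P * P * Pᴴ + P * P * P := by
    noncomm_ring
  have c : (Pᴴ * P * Pᴴ).trace = (Pᴴ * P).trace := by
    rw [Matrix.trace_mul_comm, ← mul_assoc, hP']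
  rw [e, hP, hP, mul_sub, hP]
  simp only [Matrix.trace_add, Matrix.trace_sub, c]
  rw [Matrix.trace_mul_comm P]
  ring

lemma norm_trace_skew_mul_le {E P : Matrix (Fin n) (Fin n) ℂ} {M : ℝ} (hE : ‖E‖ ≤ M) :
    ‖((Pᴴ - P) * E * (Pᴴ - P)).trace‖ ≤ (1 + M ^ 2) / 2 * frobSq (Pᴴ - P) := by
  have e : (Pᴴ - P) * E * (Pᴴ - P) = -((Pᴴ - P)ᴴ * (E * (Pᴴ - P))) := by
    rw [Matrix.conjTranspose_sub, Matrix.conjTranspose_conjTranspose]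
    noncomm_ring
  rw [e, Matrix.trace_neg, norm_neg]
  refine (norm_trace_mul_le _ _).trans ?_
  have h1 := frobSq_mul_le_left E (Pᴴ - P)
  have h2 : ‖E‖ ^ 2 * frobSq (Pᴴ - P) ≤ M ^ 2 * frobSq (Pᴴ - P) := by
    have := frobSq_nonneg (Pᴴ - P)
    gcongr
  linarith

/-- A Łojasiewicz type inequality: the departure from normality is quadratically dominated by the
self-commutator. -/
theorem exists_abs_frobSq_sub_le (s : Finset ℂ) (R : ℝ) : ∃ C, 0 < C ∧
    ∀ X : Matrix (Fin n) (Fin n) ℂ, IsAnnihilatedOn s X → ‖X‖ ≤ R →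
      |frobSq X - (aeval X (Polynomial.X * Lagrange.interpolate s id star)).trace.re| ≤
        C * frobSq (Xᴴ * X - X * Xᴴ) := by
  have hM : ∀ x, ∃ M, 0 ≤ M ∧ ∀ X : Matrix (Fin n) (Fin n) ℂ, ‖X‖ ≤ R →
      ‖spectralIdempotent s X x‖ ≤ M := fun x => exists_norm_aeval_le _ R
  have hC : ∀ x, ∃ C, 0 ≤ C ∧ ∀ X Y : Matrix (Fin n) (Fin n) ℂ, ‖X‖ ≤ R →
      ‖⁅spectralIdempotent s X x, Y⁆‖ ≤ C * ‖⁅X, Y⁆‖ := fun x => exists_norm_lie_aeval_le _ R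
  choose M hM0 hM using hM
  choose C hC0 hC using hC
  set A : ℂ → ℂ → ℝ := fun x y => ‖x‖ * ‖y‖ * ((1 + M x ^ 2) / 2 * (2 * (n * (C y * C y) ^ 2)))
    with hA
  have hA0 : ∀ x y, 0 ≤ A x y := fun x y => by positivity
  refine ⟨∑ x ∈ s, ∑ y ∈ s, A x y + 1, ?_, fun X hX hR => ?_⟩
  · have : 0 ≤ ∑ x ∈ s, ∑ y ∈ s, A x y :=
      Finset.sum_nonneg fun x _ => Finset.sum_nonneg fun y _ => hA0 x y
    linarith
  set E := spectralIdempotent s X with hE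
  set G := frobSq (Xᴴ * X - X * Xᴴ) with hG
  have hG0 : 0 ≤ G := frobSq_nonneg _
  have hEE : ∀ x, E x * E x = E x := fun x => by rw [hE, hX.idempotent_mul, if_pos rfl]
  have hcomm : ∀ x, frobSq ((E x)ᴴ - E x) ≤ 2 * (n * (C x * C x) ^ 2) * G := fun x => by
    have h1 : ⁅X, (E x)ᴴ⁆ = (⁅E x, Xᴴ⁆)ᴴ := by
      simp only [Ring.lie_def, Matrix.conjTranspose_sub, Matrix.conjTranspose_mul,
        Matrix.conjTranspose_conjTranspose]
    -- The commutator estimate is used twice: once to replace the idempotent by `X`, and once, after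
    -- taking adjoints, to replace its adjoint by `X*`.
    have h2 : ‖⁅E x, (E x)ᴴ⁆‖ ≤ C x * C x * ‖⁅X, Xᴴ⁆‖ := by
      calc ‖⁅E x, (E x)ᴴ⁆‖ ≤ C x * ‖⁅X, (E x)ᴴ⁆‖ := hC x X _ hR
        _ = C x * ‖⁅E x, Xᴴ⁆‖ := by rw [h1, Matrix.l2_opNorm_conjTranspose]
        _ ≤ C x * (C x * ‖⁅X, Xᴴ⁆‖) := mul_le_mul_of_nonneg_left (hC x X _ hR) (hC0 x)
        _ = _ := by ring
    have h3 := frobSq_le_card_mul ⁅E x, (E x)ᴴ⁆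
    rw [Fintype.card_fin] at h3
    have h4 := norm_sq_le_frobSq ⁅X, Xᴴ⁆
    rw [Ring.lie_def X, frobSq_sub_comm, ← hG, ← Ring.lie_def] at h4
    have h5 : ‖⁅E x, (E x)ᴴ⁆‖ ^ 2 ≤ (C x * C x) ^ 2 * G := by
      calc _ ≤ (C x * C x * ‖⁅X, Xᴴ⁆‖) ^ 2 := pow_le_pow_left₀ (norm_nonneg _) h2 2
        _ = (C x * C x) ^ 2 * ‖⁅X, Xᴴ⁆‖ ^ 2 := by ring
        _ ≤ _ := by gcongr
    have h6 : (n : ℝ) * ‖⁅E x, (E x)ᴴ⁆‖ ^ 2 ≤ n * ((C x * C x) ^ 2 * G) :=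
      mul_le_mul_of_nonneg_left h5 (Nat.cast_nonneg n)
    have h7 := frobSq_conjTranspose_sub_le (hEE x)
    linarith
  have htr : ∀ x y, ‖(E x * ((E y)ᴴ - E y)).trace‖ ≤
      (1 + M x ^ 2) / 2 * frobSq ((E y)ᴴ - E y) := fun x y => by
    by_cases hxy : x = y
    · subst hxy
      rw [trace_mul_sub_self (hEE x), norm_neg]
      exact norm_trace_skew_mul_le (hM x X hR)
    · rw [trace_mul_sub_of_mul_eq_zero (hEE y) (by rw [hE, hX.idempotent_mul, if_neg (Ne.symm hxy)])
        (by rw [hE, hX.idempotent_mul, if_neg hxy])]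
      exact norm_trace_skew_mul_le (hM x X hR)
  have hsum := hX.eq_sum
  have hadj : Xᴴ = ∑ y ∈ s, star y • (E y)ᴴ := by
    conv_lhs => rw [hsum]
    rw [Matrix.conjTranspose_sum]
    simp only [Matrix.conjTranspose_smul, hE]
  have hmul : ∀ Z, X * Z = ∑ x ∈ s, x • (E x * Z) := fun Z => by
    conv_lhs => rw [hsum]
    simp only [Finset.sum_mul, smul_mul_assoc, hE]
  -- The interpolant of conjugation yields the matrix that would be `X*` if `X` were normal;
  -- expanding both in idempotents isolates the differences `E_y* - E_y`.
  have hkey : ((frobSq X : ℂ) - (aeval X (Polynomial.X * Lagrange.interpolate s id star)).trace)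
      = ∑ x ∈ s, ∑ y ∈ s, x * star y * (E x * ((E y)ᴴ - E y)).trace := by
    rw [← trace_mul_conjTranspose_self, ← Matrix.trace_sub, map_mul, aeval_X, ← mul_sub,
      hX.aeval_interpolate, hadj, ← Finset.sum_sub_distrib, hmul, Matrix.trace_sum]
    refine Finset.sum_congr rfl fun x _ => ?_
    rw [Finset.mul_sum, Finset.smul_sum, Matrix.trace_sum]
    refine Finset.sum_congr rfl fun y _ => ?_
    rw [← hE, ← smul_sub, mul_smul_comm, smul_smul, Matrix.trace_smul, smul_eq_mul]
  have hre : frobSq X - (aeval X (Polynomial.X * Lagrange.interpolate s id star)).trace.re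
      = ((frobSq X : ℂ) - (aeval X (Polynomial.X * Lagrange.interpolate s id star)).trace).re := by
    simp
  rw [hre]
  refine (Complex.abs_re_le_norm _).trans ?_
  rw [hkey, add_mul, one_mul, Finset.sum_mul]
  refine le_add_of_le_of_nonneg ((norm_sum_le _ _).trans (Finset.sum_le_sum fun x _ => ?_)) hG0
  rw [Finset.sum_mul]
  refine (norm_sum_le _ _).trans (Finset.sum_le_sum fun y _ => ?_)
  rw [norm_mul, norm_mul, norm_star]
  have h1 : (1 + M x ^ 2) / 2 * frobSq ((E y)ᴴ - E y) ≤
      (1 + M x ^ 2) / 2 * (2 * (n * (C y * C y) ^ 2) * G) :=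
    mul_le_mul_of_nonneg_left (hcomm y) (by positivity)
  calc _ ≤ ‖x‖ * ‖y‖ * ((1 + M x ^ 2) / 2 * (2 * (n * (C y * C y) ^ 2) * G)) :=
        mul_le_mul_of_nonneg_left ((htr x y).trans h1) (by positivity)
    _ = A x y * G := by rw [hA]; ring

end PolynomialCalculus

/-! ### Invariance of polynomial identities along the flow. -/

section Isospectral

open Polynomial Set

variable {n : ℕ} {X Φ : ℝ → Matrix (Fin n) (Fin n) ℂ}

lemma hasDerivWithinAt_pow_lie {u : Set ℝ} {t : ℝ} {B : Matrix (Fin n) (Fin n) ℂ}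
    (h : HasDerivWithinAt X ⁅B, X t⁆ u t) (k : ℕ) :
    HasDerivWithinAt (fun t => X t ^ k) ⁅B, X t ^ k⁆ u t := by
  induction k with
  | zero =>
    simp only [pow_zero, Ring.lie_def, mul_one, one_mul, sub_self]
    exact hasDerivWithinAt_const _ _ _
  | succ k ih =>
    have h1 := ih.mul h
    have e : ⁅B, X t ^ (k + 1)⁆ = ⁅B, X t ^ k⁆ * X t + X t ^ k * ⁅B, X t⁆ := by
      simp only [Ring.lie_def, pow_succ]
      noncomm_ring
    simp only [pow_succ] at e ⊢
    rw [e]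
    exact h1

lemma hasDerivWithinAt_aeval_lie {u : Set ℝ} {t : ℝ} {B : Matrix (Fin n) (Fin n) ℂ}
    (h : HasDerivWithinAt X ⁅B, X t⁆ u t) (p : ℂ[X]) :
    HasDerivWithinAt (fun t => aeval (X t) p) ⁅B, aeval (X t) p⁆ u t := by
  induction p using Polynomial.induction_on' with
  | add p q hp hq =>
    have e : ⁅B, aeval (X t) (p + q)⁆ = ⁅B, aeval (X t) p⁆ + ⁅B, aeval (X t) q⁆ := by
      simp only [Ring.lie_def, map_add]
      noncomm_ring
    rw [e]
    simp only [map_add]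
    exact hp.add hq
  | monomial k c =>
    have e : ⁅B, aeval (X t) (monomial k c)⁆ = c • ⁅B, X t ^ k⁆ := by
      simp only [aeval_monomial, ← Algebra.smul_def, Ring.lie_def, smul_mul_assoc, mul_smul_comm,
        smul_sub]
    rw [e]
    simp only [aeval_monomial, ← Algebra.smul_def]
    exact (hasDerivWithinAt_pow_lie h k).const_smul c

/-- The curve `Z = p(X)` solves the linear equation `Z' = [Φ, Z]` with bounded coefficients, so by
Grönwall it remains zero. -/
lemma aeval_eq_zero_of_flow {M : ℝ} (hΦ : ∀ t, 0 ≤ t → ‖Φ t‖ ≤ M)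
    (hX : ∀ t, 0 ≤ t → HasDerivWithinAt X ⁅Φ t, X t⁆ (Ici 0) t) {p : ℂ[X]}
    (hp : aeval (X 0) p = 0) {t : ℝ} (ht : 0 ≤ t) : aeval (X t) p = 0 := by
  have hd := fun t ht => hasDerivWithinAt_aeval_lie (hX t ht) p
  refine eq_zero_of_abs_deriv_le_mul_abs_self_of_eq_zero_right
    (f := fun t => aeval (X t) p) (K := 2 * M) (a := 0) (b := t)
    (fun s hs => (hd s hs.1).continuousWithinAt.mono Icc_subset_Ici_self)
    (fun s hs => (hd s hs.1).mono (Ici_subset_Ici.2 hs.1)) hp (fun s hs => ?_) t ⟨ht, le_rfl⟩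
  rw [Ring.lie_def]
  have h1 := norm_sub_le (Φ s * aeval (X s) p) (aeval (X s) p * Φ s)
  have h2 := norm_mul_le (Φ s) (aeval (X s) p)
  have h3 := norm_mul_le (aeval (X s) p) (Φ s)
  have h4 := mul_le_mul_of_nonneg_right (hΦ s hs.1) (norm_nonneg (aeval (X s) p))
  linarith

/-- The trace as a continuous linear functional. -/
noncomputable def traceCLM (n : ℕ) : Matrix (Fin n) (Fin n) ℂ →L[ℝ] ℂ :=
  LinearMap.toContinuousLinearMap (Matrix.traceLinearMap (Fin n) ℝ ℂ)

end Isospectral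

/-! ### Polynomials in diagonal and conjugated matrices. -/

section Diagonalizable

open Polynomial

variable {n : ℕ} {T : Matrix (Fin n) (Fin n) ℂ}

lemma IsDiagonalizable.exists_conj (h : IsDiagonalizable T) :
    ∃ (P : GL (Fin n) ℂ) (d : Fin n → ℂ), T = P.val * Matrix.diagonal d * P⁻¹.val := by
  obtain ⟨d, P, hP⟩ := h
  refine ⟨P⁻¹, d, ?_⟩
  rw [hP, inv_inv]
  simp only [mul_assoc, Units.inv_mul, mul_one]
  rw [← mul_assoc, Units.inv_mul, one_mul]

lemma aeval_diagonal (d : Fin n → ℂ) (p : ℂ[X]) :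
    aeval (Matrix.diagonal d) p = Matrix.diagonal fun i => p.eval (d i) := by
  have h := Polynomial.aeval_algHom_apply (Matrix.diagonalAlgHom ℂ (n := Fin n) (α := ℂ)) d p
  simp only [Matrix.diagonalAlgHom_apply] at h
  rw [h]
  congr 1
  ext i
  simp [Polynomial.aeval_def]

lemma aeval_conj (P : GL (Fin n) ℂ) (A : Matrix (Fin n) (Fin n) ℂ) (p : ℂ[X]) :
    aeval (P.val * A * P⁻¹.val) p = P.val * aeval A p * P⁻¹.val := by
  induction p using Polynomial.induction_on' with
  | add p q hp hq => simp only [map_add, hp, hq, mul_add, add_mul]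
  | monomial k c =>
    simp only [aeval_monomial, ← Algebra.smul_def, Units.conj_pow, mul_smul_comm, smul_mul_assoc]

lemma trace_conj (P : GL (Fin n) ℂ) (A : Matrix (Fin n) (Fin n) ℂ) :
    (P.val * A * P⁻¹.val).trace = A.trace := by
  rw [Matrix.trace_mul_comm, ← mul_assoc, Units.inv_mul, one_mul]

end Diagonalizable

/-! ### Extension by constants and the lower slope bound away from zero. -/

section Clamp

variable {φ φ₁ φ₂ : ℝ → ℝ} {a b : ℝ}

/-- The extension of a function on `[a, b]` by constants. -/
def clampExtend (φ : ℝ → ℝ) (a b : ℝ) (x : ℝ) : ℝ := φ (max a (min b x))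

lemma clampExtend_of_mem {x : ℝ} (hx : x ∈ Set.Icc a b) : clampExtend φ a b x = φ x := by
  rw [clampExtend, min_eq_right hx.2, max_eq_right hx.1]

lemma clamp_mem (hab : a ≤ b) (x : ℝ) : max a (min b x) ∈ Set.Icc a b :=
  ⟨le_max_left _ _, max_le hab (min_le_left _ _)⟩

lemma monotone_clampExtend (hab : a ≤ b) (h : MonotoneOn φ (Set.Icc a b)) :
    Monotone (clampExtend φ a b) := fun _ _ hxy =>
  h (clamp_mem hab _) (clamp_mem hab _) (max_le_max le_rfl (min_le_min le_rfl hxy))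

lemma continuous_clampExtend (hab : a ≤ b) (h : ContinuousOn φ (Set.Icc a b)) :
    Continuous (clampExtend φ a b) :=
  h.comp_continuous (by fun_prop) (clamp_mem hab)

lemma exists_abs_clampExtend_sub_le (hab : a ≤ b)
    (h : ∃ K, LipschitzOnWith K φ (Set.Icc a b)) :
    ∃ K, 0 ≤ K ∧ ∀ x y, |clampExtend φ a b x - clampExtend φ a b y| ≤ K * |x - y| := by
  obtain ⟨K, hK⟩ := h
  refine ⟨K, K.2, fun x y => ?_⟩
  have h1 := hK.dist_le_mul _ (clamp_mem hab x) _ (clamp_mem hab y)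
  rw [Real.dist_eq, Real.dist_eq] at h1
  refine h1.trans (mul_le_mul_of_nonneg_left ?_ K.2)
  refine (abs_max_sub_max_le_max _ _ _ _).trans (max_le (by simp) ?_)
  exact (abs_min_sub_min_le_max _ _ _ _).trans (max_le (by simp) le_rfl)

lemma phi_clampExtend {n : ℕ} {X : Matrix (Fin n) (Fin n) ℂ}
    (hX : X ∈ matInterval n a b) (hX' : Xᴴ ∈ matInterval n a b) :
    phi (clampExtend φ₁ a b) (clampExtend φ₂ a b) X = phi φ₁ φ₂ X := by
  rw [phi, phi]
  congr 1
  · exact cfc_congr fun x hx => clampExtend_of_mem (hX hx)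
  · exact cfc_congr fun x hx => clampExtend_of_mem (hX' hx)

/-- On the compact interval `[l, b]`, which avoids `0`, the continuous function `φ₁' + φ₂'` attains
a positive minimum; the mean value inequality does the rest. -/
lemma CondC1.exists_mul_sub_le (h : CondC1 φ₁ φ₂ a b) {l : ℝ} (hl : 0 < l) (hal : a ≤ l) :
    ∃ κ, 0 < κ ∧ ∀ p q, l ≤ p → p ≤ q → q ≤ b →
      κ * (q - p) ≤ (φ₁ q + φ₂ q) - (φ₁ p + φ₂ p) := by
  rcases le_or_gt b l with hbl | hlb
  · refine ⟨1, one_pos, fun p q hp hpq hq => ?_⟩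
    have : p = q := by linarith
    subst this
    simp
  have hab : a < b := hal.trans_lt hlb
  have hsub : Set.Icc l b ⊆ Set.Icc a b := Set.Icc_subset_Icc_left hal
  have hu : UniqueDiffOn ℝ (Set.Icc a b) := uniqueDiffOn_Icc hab
  set g : ℝ → ℝ := fun x =>
    derivWithin φ₁ (Set.Icc a b) x + derivWithin φ₂ (Set.Icc a b) x with hg
  have hgc : ContinuousOn g (Set.Icc l b) :=
    ((h.contDiffOn₁.continuousOn_derivWithin hu le_rfl).add
      (h.contDiffOn₂.continuousOn_derivWithin hu le_rfl)).mono hsub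
  obtain ⟨x₀, hx₀, hmin⟩ := isCompact_Icc.exists_isMinOn (Set.nonempty_Icc.2 hlb.le) hgc
  refine ⟨g x₀, h.deriv_pos x₀ ⟨hsub hx₀, (hl.trans_le hx₀.1).ne'⟩, fun p q hp hpq hq => ?_⟩
  refine (convex_Icc l b).mul_sub_le_image_sub_of_le_deriv (f := fun x => φ₁ x + φ₂ x)
    ((h.continuousOn₁.add h.continuousOn₂).mono hsub) ?_ ?_ p ⟨hp, hpq.trans hq⟩ q
    ⟨hp.trans hpq, hq⟩ hpq
  all_goals rw [interior_Icc]
  · intro x hx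
    have hx' : Set.Icc a b ∈ nhds x := Icc_mem_nhds (hal.trans_lt hx.1) hx.2
    exact (((h.contDiffOn₁.differentiableOn one_ne_zero x (mem_of_mem_nhds hx')).differentiableAt
      hx').add ((h.contDiffOn₂.differentiableOn one_ne_zero x
        (mem_of_mem_nhds hx')).differentiableAt hx')).differentiableWithinAt
  · intro x hx
    have hx' : Set.Icc a b ∈ nhds x := Icc_mem_nhds (hal.trans_lt hx.1) hx.2
    have d1 := (h.contDiffOn₁.differentiableOn one_ne_zero x (mem_of_mem_nhds hx')).differentiableAt
      hx'
    have d2 := (h.contDiffOn₂.differentiableOn one_ne_zero x (mem_of_mem_nhds hx')).differentiableAt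
      hx'
    have e : deriv (fun x => φ₁ x + φ₂ x) x = g x := by
      simp only [hg]
      rw [deriv_fun_add d1 d2, derivWithin_of_mem_nhds hx', derivWithin_of_mem_nhds hx']
    rw [e]
    exact hmin ⟨hx.1.le, hx.2.le⟩

end Clamp

/-! ### Convexity estimates in the variable `x²`. -/

section Bregman

open intervalIntegral MeasureTheory

/-- A primitive of `φ` with respect to `d(x²)`. -/
noncomputable def sqPrimitive (φ : ℝ → ℝ) (x : ℝ) : ℝ := ∫ s in (0 : ℝ)..x, φ s * (2 * s)

lemma sqPrimitive_bounds {φ : ℝ → ℝ} (hc : Continuous φ) (hm : Monotone φ) {x y : ℝ}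
    (hx : 0 ≤ x) (hxy : x ≤ y) :
    φ x * (y ^ 2 - x ^ 2) ≤ sqPrimitive φ y - sqPrimitive φ x ∧
      sqPrimitive φ y - sqPrimitive φ x ≤ φ y * (y ^ 2 - x ^ 2) := by
  have hi : ∀ u v : ℝ, IntervalIntegrable (fun s => φ s * (2 * s)) volume u v := fun u v =>
    (Continuous.intervalIntegrable (by fun_prop) u v)
  have hi2 : ∀ c u v : ℝ, IntervalIntegrable (fun s => c * (2 * s)) volume u v := fun c u v =>
    (Continuous.intervalIntegrable (by fun_prop) u v)
  have e : sqPrimitive φ y - sqPrimitive φ x = ∫ s in x..y, φ s * (2 * s) := by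
    rw [sqPrimitive, sqPrimitive, integral_interval_sub_left (hi _ _) (hi _ _)]
  have ec : ∀ c : ℝ, c * (y ^ 2 - x ^ 2) = ∫ s in x..y, c * (2 * s) := fun c => by
    rw [intervalIntegral.integral_const_mul, intervalIntegral.integral_const_mul, integral_id]
    ring
  rw [e, ec, ec]
  constructor
  · refine integral_mono_on hxy (hi2 _ _ _) (hi _ _) fun s hs => ?_
    exact mul_le_mul_of_nonneg_right (hm hs.1) (by linarith [hs.1])
  · refine integral_mono_on hxy (hi _ _) (hi2 _ _ _) fun s hs => ?_
    exact mul_le_mul_of_nonneg_right (hm hs.2) (by linarith [hs.1])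

/-- A quantitative strict convexity estimate. -/
lemma bregman_lower_bound {f g : ℝ → ℝ} (hfc : Continuous f) (hgc : Continuous g)
    (hf : Monotone f) (hg : Monotone g) {κ m x y : ℝ} (hx : 0 ≤ x) (hxy : x < y)
    (hm : 0 ≤ m) (hmy : m ≤ y) (hκ : ∀ p q, m / 3 ≤ p → x ≤ p → p ≤ q → q ≤ y →
      κ * (q - p) ≤ (f q + g q) - (f p + g p)) :
    κ * m / 27 * (x - y) ^ 2 ≤ (sqPrimitive f y - sqPrimitive f x - f x * (y ^ 2 - x ^ 2))
      + (g y * (y ^ 2 - x ^ 2) - (sqPrimitive g y - sqPrimitive g x)) := by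
  -- Cut `[x, y]` into thirds. The increase of `f + g` over the middle third is collected by `f` on
  -- the last third and by `g` on the first, each of length at least `δ * (m / 3)` in the variable
  -- `x²`. Since `(x - y)² = 9δ²`, the constant is `1 / 27`.
  obtain ⟨δ, hδ⟩ : ∃ δ, δ = (y - x) / 3 := ⟨_, rfl⟩
  have hδ0 : 0 < δ := by rw [hδ]; linarith
  obtain ⟨p, hp⟩ : ∃ p, p = x + δ := ⟨_, rfl⟩
  obtain ⟨q, hq⟩ : ∃ q, q = p + δ := ⟨_, rfl⟩
  have hy : y = q + δ := by rw [hq, hp, hδ]; ring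
  have hpm : m / 3 ≤ p := by rw [hp, hδ]; linarith
  have f1 := (sqPrimitive_bounds hfc hf (by linarith : 0 ≤ q) (by linarith : q ≤ y)).1
  have f2 := (sqPrimitive_bounds hfc hf hx (by linarith : x ≤ q)).1
  have g1 := (sqPrimitive_bounds hgc hg (by linarith : 0 ≤ p) (by linarith : p ≤ y)).2
  have g2 := (sqPrimitive_bounds hgc hg hx (by linarith : x ≤ p)).2
  have hk := hκ p q hpm (by linarith) (by linarith) (by linarith)
  have mf : f x ≤ f p := hf (by linarith)
  have mf' : f p ≤ f q := hf (by linarith)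
  have mg : g q ≤ g y := hg (by linarith)
  have mg' : g p ≤ g q := hg (by linarith)
  have s1 : δ * (m / 3) ≤ y ^ 2 - q ^ 2 := by
    have : y ^ 2 - q ^ 2 = δ * (y + q) := by rw [hy]; ring
    rw [this]
    exact mul_le_mul_of_nonneg_left (by linarith) hδ0.le
  have s2 : δ * (m / 3) ≤ p ^ 2 - x ^ 2 := by
    have : p ^ 2 - x ^ 2 = δ * (p + x) := by rw [hp]; ring
    rw [this]
    exact mul_le_mul_of_nonneg_left (by linarith) hδ0.le
  have hs0 : 0 ≤ δ * (m / 3) := by positivity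
  have F : (f q - f p) * (δ * (m / 3)) ≤
      sqPrimitive f y - sqPrimitive f x - f x * (y ^ 2 - x ^ 2) := by
    have h1 : (f q - f p) * (δ * (m / 3)) ≤ (f q - f x) * (y ^ 2 - q ^ 2) :=
      mul_le_mul (by linarith) s1 hs0 (by linarith)
    linarith
  have G : (g q - g p) * (δ * (m / 3)) ≤
      g y * (y ^ 2 - x ^ 2) - (sqPrimitive g y - sqPrimitive g x) := by
    have h1 : (g q - g p) * (δ * (m / 3)) ≤ (g y - g p) * (p ^ 2 - x ^ 2) :=
      mul_le_mul (by linarith) s2 hs0 (by linarith)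
    linarith
  have K : κ * (q - p) * (δ * (m / 3)) ≤ ((f q + g q) - (f p + g p)) * (δ * (m / 3)) :=
    mul_le_mul_of_nonneg_right hk hs0
  have e : κ * m / 27 * (x - y) ^ 2 = κ * (q - p) * (δ * (m / 3)) := by
    have h1 : q - p = δ := by linarith
    have h2 : x - y = -(3 * δ) := by linarith
    rw [h1, h2]
    ring
  rw [e]
  linarith

end Bregman

/-! ### Decay rate of the Frobenius norm along the flow. -/

section Dissipation

variable {n : ℕ} {φ₁ φ₂ : ℝ → ℝ} {X : Matrix (Fin n) (Fin n) ℂ}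

lemma isHermitian_phi : (phi φ₁ φ₂ X).IsHermitian := by
  rw [Matrix.IsHermitian, phi, Matrix.conjTranspose_sub, isSelfAdjoint_cfc, isSelfAdjoint_cfc]

/-- The derivative of the squared Frobenius norm along the flow. -/
lemma hasDerivWithinAt_frobSq {Z : ℝ → Matrix (Fin n) (Fin n) ℂ} {u : Set ℝ} {t : ℝ}
    (h : HasDerivWithinAt Z ⁅phi φ₁ φ₂ (Z t), Z t⁆ u t) :
    HasDerivWithinAt (fun t => frobSq (Z t))
      (-(2 * (phi φ₁ φ₂ (Z t) * ((Z t)ᴴ * Z t - Z t * (Z t)ᴴ)).trace.re)) u t := by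
  have h1 := h.star.mul h
  have h2 := (traceCLM n).hasFDerivAt.comp_hasDerivWithinAt t h1
  have h3 := Complex.reCLM.hasFDerivAt.comp_hasDerivWithinAt t h2
  have e1 : (fun t => frobSq (Z t)) =
      Complex.reCLM ∘ (traceCLM n ∘ ((fun t => star (Z t)) * Z)) := by
    ext s
    have : (traceCLM n (star (Z s) * Z s)) = (frobSq (Z s) : ℂ) :=
      trace_conjTranspose_mul_self (Z s)
    show frobSq (Z s) = (traceCLM n (star (Z s) * Z s)).re
    rw [this, Complex.ofReal_re]
  have e2 : -(2 * (phi φ₁ φ₂ (Z t) * ((Z t)ᴴ * Z t - Z t * (Z t)ᴴ)).trace.re) =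
      (star ⁅phi φ₁ φ₂ (Z t), Z t⁆ * Z t + star (Z t) * ⁅phi φ₁ φ₂ (Z t), Z t⁆).trace.re := by
    rw [Matrix.star_eq_conjTranspose, Matrix.star_eq_conjTranspose, Ring.lie_def,
      Matrix.conjTranspose_sub, Matrix.conjTranspose_mul, Matrix.conjTranspose_mul,
      isHermitian_phi.eq]
    set P := phi φ₁ φ₂ (Z t)
    set A := Z t
    have c1 : (Aᴴ * P * A).trace = (P * (A * Aᴴ)).trace := by
      rw [mul_assoc, Matrix.trace_mul_comm, mul_assoc]
    have c2 : (Aᴴ * (P * A)).trace = (P * (A * Aᴴ)).trace := by rw [← mul_assoc, c1]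
    have c3 : (Aᴴ * (A * P)).trace = (P * (Aᴴ * A)).trace := by
      rw [← mul_assoc, Matrix.trace_mul_comm]
    have c4 : (P * Aᴴ * A).trace = (P * (Aᴴ * A)).trace := by rw [mul_assoc]
    rw [sub_mul, mul_sub, mul_sub]
    simp only [Matrix.trace_add, Matrix.trace_sub, c1, c2, c3, c4, Complex.add_re, Complex.sub_re]
    ring
  rw [e1, e2]
  exact h3

/-- The dissipation dominates the distance of `|X|` and `|X*|`. -/
lemma mul_frobSq_le_dissipation {c : ℝ} {Θ : ℝ → ℝ}
    (h : ∀ x ∈ spectrum ℝ (matAbs X), ∀ y ∈ spectrum ℝ (matAbs Xᴴ),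
      c * (x - y) ^ 2 ≤ (φ₁ x - φ₂ y) * (x ^ 2 - y ^ 2) + (Θ y - Θ x)) :
    c * frobSq (matAbs X - matAbs Xᴴ) ≤
      (phi φ₁ φ₂ X * (Xᴴ * X - X * Xᴴ)).trace.re := by
  have hA := isHermitian_matAbs X
  have hB := isHermitian_matAbs Xᴴ
  obtain ⟨w, α, β, hw, hα, hβ, hwt⟩ := exists_spectral_weights hA hB
  have h0 := frobSq_cfc_sub_cfc hwt hA hB (fun x => x) (fun x => x)
  rw [cfc_self hA, cfc_self hB] at h0
  have t1 := hwt (fun x => φ₁ x * x ^ 2) (fun _ => 1)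
  have t2 := hwt φ₁ (fun x => x ^ 2)
  have t3 := hwt (fun x => x ^ 2) φ₂
  have t4 := hwt (fun _ => 1) (fun x => φ₂ x * x ^ 2)
  have t5 := hwt Θ (fun _ => 1)
  have t6 := hwt (fun _ => 1) Θ
  have hB2 : cfc (fun x : ℝ => x ^ 2) (matAbs Xᴴ) = X * Xᴴ := by
    rw [cfc_sq_matAbs, Matrix.conjTranspose_conjTranspose]
  rw [cfc_one_eq hB, mul_one, ← cfc_mul_eq, cfc_sq_matAbs] at t1
  rw [hB2] at t2
  rw [cfc_sq_matAbs, Matrix.trace_mul_comm] at t3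
  rw [cfc_one_eq hA, one_mul, ← cfc_mul_eq, hB2] at t4
  rw [cfc_one_eq hB, mul_one, ← trace_cfc_matAbs] at t5
  rw [cfc_one_eq hA, one_mul, t5] at t6
  have t7 := Complex.ofReal_injective t6
  have hD : (phi φ₁ φ₂ X * (Xᴴ * X - X * Xᴴ)).trace.re =
      ∑ i, ∑ j, w i j * ((φ₁ (α i) - φ₂ (β j)) * (α i ^ 2 - β j ^ 2)) := by
    rw [phi, sub_mul, mul_sub, mul_sub]
    simp only [Matrix.trace_sub, t1, t2, t3, t4, Complex.sub_re, Complex.ofReal_re,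
      ← Finset.sum_sub_distrib]
    refine Finset.sum_congr rfl fun i _ => Finset.sum_congr rfl fun j _ => ?_
    ring
  -- `|X|` and `|X*|` give `Θ` the same trace, so a term `Θ y - Θ x` may be added to the scalar
  -- inequality at no cost.
  have hΘ : ∑ i, ∑ j, w i j * (Θ (β j) - Θ (α i)) = 0 := by
    simp only [mul_one, one_mul] at t7
    simp only [mul_sub, Finset.sum_sub_distrib]
    rw [t7, sub_self]
  rw [hD, h0]
  refine le_of_le_of_eq ?_ (add_zero _)
  rw [← hΘ]
  simp only [Finset.mul_sum, ← Finset.sum_add_distrib]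
  refine Finset.sum_le_sum fun i _ => Finset.sum_le_sum fun j _ => ?_
  have := mul_le_mul_of_nonneg_left (h _ (hα i) _ (hβ j)) (hw i j)
  linarith

/-- Squaring has Lipschitz constant `2 * R` on `[0, R]`, which contains both spectra. -/
lemma frobSq_selfCommutator_le {R : ℝ} (hR : ‖X‖ ≤ R) :
    frobSq (Xᴴ * X - X * Xᴴ) ≤ (2 * R) ^ 2 * frobSq (matAbs X - matAbs Xᴴ) := by
  have h := frobSq_cfc_sub_le (isHermitian_matAbs X) (isHermitian_matAbs Xᴴ)
    (f := fun x => x ^ 2) (K := 2 * R) fun x hx y hy => by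
      have hx0 := nonneg_of_mem_spectrum_matAbs hx
      have hy0 := nonneg_of_mem_spectrum_matAbs hy
      have hx1 := (le_norm_of_mem_spectrum_matAbs hx).trans hR
      have hy1 := (le_norm_of_mem_spectrum_matAbs hy).trans
        ((Matrix.l2_opNorm_conjTranspose X).trans_le hR)
      rw [sq_sub_sq, abs_mul, abs_of_nonneg (add_nonneg hx0 hy0)]
      exact mul_le_mul_of_nonneg_right (by linarith) (abs_nonneg _)
  rwa [cfc_sq_matAbs, cfc_sq_matAbs, Matrix.conjTranspose_conjTranspose] at h

end Dissipation

/-! ### Similarity orbits: local constancy and closedness. -/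

section Similarity

open Polynomial Filter Topology

variable {n : ℕ} {A B C : Matrix (Fin n) (Fin n) ℂ}

lemma mem_similarityOrbit_trans (h₁ : B ∈ similarityOrbit A) (h₂ : C ∈ similarityOrbit B) :
    C ∈ similarityOrbit A := by
  obtain ⟨P, rfl⟩ := h₁
  obtain ⟨Q, rfl⟩ := h₂
  refine ⟨Q * P, ?_⟩
  rw [mul_inv_rev]
  simp only [Units.val_mul, mul_assoc]

lemma mem_similarityOrbit_symm (h : B ∈ similarityOrbit A) : A ∈ similarityOrbit B := by
  obtain ⟨P, rfl⟩ := h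
  refine ⟨P⁻¹, ?_⟩
  rw [inv_inv]
  simp only [mul_assoc, Units.inv_mul, mul_one]
  rw [← mul_assoc, Units.inv_mul, one_mul]

lemma mem_similarityOrbit_of_mul_eq {W : Matrix (Fin n) (Fin n) ℂ} (hW : IsUnit W)
    (h : B * W = W * A) : B ∈ similarityOrbit A := by
  obtain ⟨P, rfl⟩ := hW
  refine ⟨P, ?_⟩
  rw [← h, mul_assoc, Units.mul_inv, mul_one]

lemma trace_aeval_of_mem_similarityOrbit (h : B ∈ similarityOrbit A) (p : ℂ[X]) :
    (aeval B p).trace = (aeval A p).trace := by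
  obtain ⟨P, rfl⟩ := h
  rw [aeval_conj, trace_conj]

variable {s : Finset ℂ}

lemma IsAnnihilatedOn.sum_spectralIdempotent (h : IsAnnihilatedOn s A) :
    ∑ x ∈ s, spectralIdempotent s A x = 1 := by
  have h1 := h.aeval_interpolate fun _ => 1
  simp only [one_smul] at h1
  rw [← h1, ← map_one (aeval A : ℂ[X] →ₐ[ℂ] _)]
  exact h.aeval_congr fun z hz => by rw [eval_interpolate_id _ hz, eval_one]

lemma IsAnnihilatedOn.mul_spectralIdempotent (h : IsAnnihilatedOn s A) (x : ℂ) :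
    A * spectralIdempotent s A x = x • spectralIdempotent s A x := by
  have h1 : aeval A ((Polynomial.X : ℂ[X]) *
      Lagrange.interpolate s id fun y => if y = x then 1 else 0) =
      aeval A (x • Lagrange.interpolate s id fun y => if y = x then (1 : ℂ) else 0) :=
    h.aeval_congr fun z hz => by
      rw [eval_mul, eval_X, eval_smul, eval_interpolate_id _ hz, smul_eq_mul]
      split_ifs with hzx
      · rw [hzx]
      · simp
  rwa [map_mul, aeval_X, map_smul] at h1

lemma IsAnnihilatedOn.spectralIdempotent_mul (h : IsAnnihilatedOn s A) (x : ℂ) :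
    spectralIdempotent s A x * A = x • spectralIdempotent s A x := by
  rw [← h.mul_spectralIdempotent]
  have h1 : Commute (aeval A (Lagrange.interpolate s id fun y => if y = x then (1 : ℂ) else 0))
      (aeval A (Polynomial.X : ℂ[X])) := by
    rw [Commute, SemiconjBy, ← map_mul, ← map_mul, mul_comm]
  rw [aeval_X] at h1
  exact h1

/-- Nearby diagonalizable matrices with spectrum in the same finite set are similar. -/
lemma IsAnnihilatedOn.eventually_mem_similarityOrbit (h : IsAnnihilatedOn s A) :
    ∀ᶠ B in 𝓝 A, IsAnnihilatedOn s B → B ∈ similarityOrbit A := by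
  -- `W B` matches the idempotents of `B` with those of `A`, so it intertwines `B` and `A`; it is
  -- `1` at `A`, hence invertible nearby.
  set W : Matrix (Fin n) (Fin n) ℂ → Matrix (Fin n) (Fin n) ℂ := fun B =>
    ∑ x ∈ s, spectralIdempotent s B x * spectralIdempotent s A x with hW
  have hc : Continuous W := by
    refine continuous_finsetSum _ fun x _ => Continuous.mul ?_ continuous_const
    exact Polynomial.continuous_aeval _
  have hWA : W A = 1 := by
    rw [hW, ← h.sum_spectralIdempotent]
    refine Finset.sum_congr rfl fun x _ => ?_
    rw [h.idempotent_mul, if_pos rfl]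
  have hu : ∀ᶠ B in 𝓝 A, IsUnit (W B) := by
    refine hc.continuousAt.eventually ?_
    rw [hWA]
    exact Units.isOpen.mem_nhds isUnit_one
  filter_upwards [hu] with B hB hBs
  refine mem_similarityOrbit_of_mul_eq hB ?_
  rw [hW, Finset.mul_sum, Finset.sum_mul]
  refine Finset.sum_congr rfl fun x _ => ?_
  rw [← mul_assoc, hBs.mul_spectralIdempotent, mul_assoc _ _ A, h.spectralIdempotent_mul,
    smul_mul_assoc, mul_smul_comm]

lemma IsAnnihilatedOn.of_tendsto {ι : Type*} {l : Filter ι} [l.NeBot]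
    {Z : ι → Matrix (Fin n) (Fin n) ℂ} (hZ : Tendsto Z l (𝓝 A))
    (h : ∀ᶠ i in l, IsAnnihilatedOn s (Z i)) : IsAnnihilatedOn s A := by
  intro p hp
  have h1 : Tendsto (fun i => aeval (Z i) p) l (𝓝 (aeval A p)) :=
    ((Polynomial.continuous_aeval p).tendsto A).comp hZ
  exact tendsto_nhds_unique_of_eventuallyEq h1 tendsto_const_nhds (h.mono fun i hi => hi p hp)

lemma mem_similarityOrbit_of_continuousOn {Z : ℝ → Matrix (Fin n) (Fin n) ℂ}
    (hZ : ContinuousOn Z (Set.Ici 0)) (h : ∀ t, 0 ≤ t → IsAnnihilatedOn s (Z t)) {t : ℝ}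
    (ht : 0 ≤ t) : Z t ∈ similarityOrbit (Z 0) := by
  refine isPreconnected_Ici.induction₂ (fun x y => Z y ∈ similarityOrbit (Z x)) ?_ ?_ ?_
    (Set.mem_Ici.2 le_rfl) (Set.mem_Ici.2 ht)
  · intro x hx
    filter_upwards [(hZ x hx).eventually (h x hx).eventually_mem_similarityOrbit,
      self_mem_nhdsWithin] with y hy hy0
    exact hy (h y hy0)
  · exact fun x y z _ _ _ h1 h2 => mem_similarityOrbit_trans h1 h2
  · exact fun x y _ _ h1 => mem_similarityOrbit_symm h1

lemma IsDiagonalizable.exists_isAnnihilatedOn (h : IsDiagonalizable A) :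
    ∃ s : Finset ℂ, IsAnnihilatedOn s A := by
  obtain ⟨P, d, rfl⟩ := h.exists_conj
  refine ⟨Finset.univ.image d, fun p hp => ?_⟩
  rw [aeval_conj, aeval_diagonal]
  have : (fun i => p.eval (d i)) = fun _ => 0 := by
    ext i
    exact hp _ (Finset.mem_image_of_mem d (Finset.mem_univ i))
  rw [this, Matrix.diagonal_zero, mul_zero, zero_mul]

end Similarity

/-! ### Differential inequalities and exponential convergence. -/

section Convergence

open Filter Topology Set

variable {f f' : ℝ → ℝ}

lemma antitoneOn_of_hasDerivWithinAt_Ici {a : ℝ}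
    (hf : ∀ t ∈ Ici a, HasDerivWithinAt f (f' t) (Ici a) t) (h : ∀ t ∈ Ici a, f' t ≤ 0) :
    AntitoneOn f (Ici a) :=
  antitoneOn_of_hasDerivWithinAt_nonpos (convex_Ici a)
    (fun t ht => (hf t ht).continuousWithinAt)
    (fun t ht => (hf t (interior_subset ht)).mono interior_subset)
    (fun t ht => h t (interior_subset ht))

lemma le_zero_of_tendsto_of_deriv_le {g : ℝ → ℝ} {m l : ℝ}
    (hf : ∀ t, 0 ≤ t → HasDerivWithinAt f (f' t) (Ici 0) t) (h : ∀ t, 0 ≤ t → f' t ≤ -g t)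
    (hm : ∀ t, 0 ≤ t → m ≤ f t) (hg : Tendsto g atTop (𝓝 l)) : l ≤ 0 := by
  by_contra! hl
  obtain ⟨t₀, ht₀⟩ := eventually_atTop.1 (hg.eventually (lt_mem_nhds (half_lt_self hl)))
  set t₁ := max t₀ 0
  have ht₁ : 0 ≤ t₁ := le_max_right _ _
  have ha : AntitoneOn (fun t => f t + l / 2 * t) (Ici t₁) := by
    refine antitoneOn_of_hasDerivWithinAt_Ici (f' := fun t => f' t + l / 2 * 1)
      (fun t ht => ?_) fun t ht => ?_
    · exact ((hf t (ht₁.trans ht)).mono (Ici_subset_Ici.2 ht₁)).add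
        ((hasDerivWithinAt_id t _).const_mul _)
    · have h1 := ht₀ t ((le_max_left _ _).trans ht)
      have h2 := h t (ht₁.trans ht)
      linarith
  set t₂ := t₁ + (f t₁ - m + 1) / (l / 2) with ht₂
  have h0 : 0 ≤ (f t₁ - m + 1) / (l / 2) := by
    have := hm t₁ ht₁
    exact div_nonneg (by linarith) (by linarith)
  have h12 : t₁ ≤ t₂ := by linarith
  have h1 := ha (mem_Ici.2 le_rfl) (mem_Ici.2 h12) h12
  have h2 := hm t₂ (ht₁.trans h12)
  have h3 : l / 2 * t₂ = l / 2 * t₁ + (f t₁ - m + 1) := by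
    rw [ht₂]
    field_simp
  simp only at h1
  linarith

/-- Exponential decay from a differential inequality and boundedness below. -/
lemma nonneg_and_le_exp_of_deriv_le {κ m : ℝ} (hκ : 0 < κ)
    (hf : ∀ t, 0 ≤ t → HasDerivWithinAt f (f' t) (Ici 0) t)
    (h : ∀ t, 0 ≤ t → f' t ≤ -(κ * |f t|)) (hm : ∀ t, 0 ≤ t → m ≤ f t) {t : ℝ} (ht : 0 ≤ t) :
    0 ≤ f t ∧ f t ≤ f 0 * Real.exp (-κ * t) := by
  have hd : ∀ c t, 0 ≤ t → HasDerivWithinAt (fun t => Real.exp (c * t) * f t)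
      (Real.exp (c * t) * (c * f t + f' t)) (Ici 0) t := fun c t ht => by
    have h1 : HasDerivWithinAt (fun t => Real.exp (c * t)) (Real.exp (c * t) * (c * 1)) (Ici 0) t :=
      ((hasDerivWithinAt_id t _).const_mul c).exp
    exact (h1.mul (hf t ht)).congr_deriv (by ring)
  -- Antitonicity with weight `exp (κ * t)` gives decay. With weight `exp (-κ * t)` it would drive a
  -- negative value exponentially to `-∞`, against the lower bound `m`.
  have hp : AntitoneOn (fun t => Real.exp (κ * t) * f t) (Ici 0) :=
    antitoneOn_of_hasDerivWithinAt_Ici (hd κ) fun t ht => by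
      have h1 := h t ht
      have h2 := mul_le_mul_of_nonneg_left (le_abs_self (f t)) hκ.le
      exact mul_nonpos_of_nonneg_of_nonpos (Real.exp_pos _).le (by linarith)
  have hn : AntitoneOn (fun t => Real.exp (-κ * t) * f t) (Ici 0) :=
    antitoneOn_of_hasDerivWithinAt_Ici (hd (-κ)) fun t ht => by
      have h1 := h t ht
      have h2 := mul_le_mul_of_nonneg_left (neg_abs_le (f t)) hκ.le
      exact mul_nonpos_of_nonneg_of_nonpos (Real.exp_pos _).le (by linarith)
  constructor
  · by_contra! hneg
    set ε := -(Real.exp (-κ * t) * f t) with hε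
    have hε0 : 0 < ε := by
      have := mul_neg_of_pos_of_neg (Real.exp_pos (-κ * t)) hneg
      linarith
    set r := t + |m| / (ε * κ) with hr
    have htr : t ≤ r := by
      have : 0 ≤ |m| / (ε * κ) := by positivity
      linarith
    have h1 : Real.exp (-κ * r) * f r ≤ -ε := by
      have := hn (mem_Ici.2 ht) (mem_Ici.2 (ht.trans htr)) htr
      simp only at this
      linarith
    have h2 : f r ≤ -ε * Real.exp (κ * r) := by
      have h3 : Real.exp (κ * r) * Real.exp (-κ * r) = 1 := by
        rw [← Real.exp_add]
        simp
      have h4 := mul_le_mul_of_nonneg_left h1 (Real.exp_pos (κ * r)).le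
      rw [← mul_assoc, h3, one_mul] at h4
      linarith
    have h5 := Real.add_one_le_exp (κ * r)
    have h6 := hm r (ht.trans htr)
    have h7 : ε * (κ * r) = ε * κ * t + |m| := by
      rw [hr]
      field_simp
    have h8 : 0 ≤ ε * κ * t := by positivity
    have h9 := mul_le_mul_of_nonneg_left h5 hε0.le
    have h10 := neg_abs_le m
    linarith
  · have h1 := hp (mem_Ici.2 le_rfl) (mem_Ici.2 ht) ht
    simp only [mul_zero, Real.exp_zero, one_mul] at h1
    have h3 : Real.exp (-κ * t) * Real.exp (κ * t) = 1 := by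
      rw [← Real.exp_add]
      simp
    have h4 := mul_le_mul_of_nonneg_left h1 (Real.exp_pos (-κ * t)).le
    rw [← mul_assoc, h3, one_mul] at h4
    linarith

variable {E : Type*} [NormedAddCommGroup E] [NormedSpace ℝ E]

/-- Exponential convergence of a curve whose velocity is controlled by a Lyapunov function. -/
theorem exists_exponential_limit [CompleteSpace E] {X V : ℝ → E} {κ C m : ℝ}
    (hκ : 0 < κ) (hC : 0 ≤ C) (hX : ∀ t, 0 ≤ t → HasDerivWithinAt X (V t) (Ici 0) t)
    (hf : ∀ t, 0 ≤ t → HasDerivWithinAt f (f' t) (Ici 0) t)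
    (h : ∀ t, 0 ≤ t → f' t ≤ -(κ * |f t|)) (hm : ∀ t, 0 ≤ t → m ≤ f t)
    (hV : ∀ t, 0 ≤ t → ‖V t‖ ^ 2 ≤ C * (-f' t)) :
    ∃ N : E, ∃ C' > 0, ∃ c > 0, ∀ t : ℝ, 0 ≤ t → ‖X t - N‖ ≤ C' * Real.exp (-c * t) := by
  have hdec := fun t ht => nonneg_and_le_exp_of_deriv_le hκ hf h hm (t := t) ht
  obtain ⟨γ, hγ⟩ : ∃ γ, γ = κ / 2 := ⟨_, rfl⟩
  have hγ0 : 0 < γ := by rw [hγ]; positivity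
  have hf0 : 0 ≤ f 0 := (hdec 0 le_rfl).1
  set D := 1 / (2 * γ) + C * f 0 with hD
  have hD0 : 0 < D := by positivity
  have key : ∀ t s, 0 ≤ t → t ≤ s → ‖X s - X t‖ ≤ D * Real.exp (-γ * t) := by
    intro t s ht hts
    -- A primitive of a bound on the speed: `2‖V‖ ≤ exp (-γτ) + exp (γτ)‖V‖²`, with `‖V‖² ≤ C(-f')`.
    -- The choice `γ = κ / 2` gives `γ f ≤ -f' / 2`, which absorbs the derivative of the weight.
    set β : ℝ → ℝ := fun τ => -(1 / (2 * γ)) * Real.exp (-γ * τ) - C * (Real.exp (γ * τ) * f τ)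
      with hβ
    set β' : ℝ → ℝ := fun τ => Real.exp (-γ * τ) / 2
      - C * (Real.exp (γ * τ) * (γ * f τ + f' τ)) with hβ'
    have hexp : ∀ c τ, HasDerivWithinAt (fun t => Real.exp (c * t)) (Real.exp (c * τ) * (c * 1))
        (Ici 0) τ := fun c τ => ((hasDerivWithinAt_id τ _).const_mul c).exp
    have hβd : ∀ τ, 0 ≤ τ → HasDerivWithinAt β (β' τ) (Ici 0) τ := fun τ hτ => by
      have h1 := ((hexp (-γ) τ).const_mul (-(1 / (2 * γ)))).sub
        (((hexp γ τ).mul (hf τ hτ)).const_mul C)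
      refine h1.congr_deriv ?_
      simp only [hβ']
      field_simp
    have hbound := image_norm_le_of_norm_deriv_right_le_deriv_boundary' (a := t) (b := s)
      (f := fun τ => X τ - X t) (f' := V) (B := fun τ => β τ - β t) (B' := β')
      (fun τ hτ => (((hX τ (ht.trans hτ.1)).continuousWithinAt).mono
        (fun x hx => ht.trans hx.1)).sub continuousWithinAt_const)
      (fun τ hτ => ((hX τ (ht.trans hτ.1)).mono (Ici_subset_Ici.2 (ht.trans hτ.1))).sub_const _)
      (by simp)
      (fun τ hτ => (((hβd τ (ht.trans hτ.1)).continuousWithinAt).mono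
        (fun x hx => ht.trans hx.1)).sub continuousWithinAt_const)
      (fun τ hτ => ((hβd τ (ht.trans hτ.1)).mono (Ici_subset_Ici.2 (ht.trans hτ.1))).sub_const _)
      (fun τ hτ => ?_) (⟨hts, le_rfl⟩ : s ∈ Icc t s)
    · refine hbound.trans ?_
      have h1 := (hdec s (ht.trans hts)).1
      have h2 := (hdec t ht).2
      have h3 : Real.exp (γ * t) * f t ≤ f 0 * Real.exp (-γ * t) := by
        have e : Real.exp (γ * t) * Real.exp (-κ * t) = Real.exp (-γ * t) := by
          rw [← Real.exp_add, hγ]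
          congr 1
          ring
        calc _ ≤ Real.exp (γ * t) * (f 0 * Real.exp (-κ * t)) :=
              mul_le_mul_of_nonneg_left h2 (Real.exp_pos _).le
          _ = f 0 * (Real.exp (γ * t) * Real.exp (-κ * t)) := by ring
          _ = _ := by rw [e]
      have h4 := mul_le_mul_of_nonneg_left h3 hC
      have h5 : 0 ≤ C * (Real.exp (γ * s) * f s) := by positivity
      have h6 : 0 ≤ 1 / (2 * γ) * Real.exp (-γ * s) := by positivity
      simp only [hβ, hD]
      linarith
    · have hτ0 : 0 ≤ τ := ht.trans hτ.1
      have h1 := hV τ hτ0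
      have h2 := (hdec τ hτ0).1
      have h3 := h τ hτ0
      rw [abs_of_nonneg h2] at h3
      have e1 : Real.exp (γ * τ) * Real.exp (-γ * τ) = 1 := by
        rw [← Real.exp_add]
        simp
      have p1 := Real.exp_pos (γ * τ)
      have p2 := Real.exp_pos (-γ * τ)
      have h4 : 2 * ‖V τ‖ ≤ Real.exp (-γ * τ) + Real.exp (γ * τ) * ‖V τ‖ ^ 2 := by
        nlinarith [mul_nonneg p2.le (sq_nonneg (Real.exp (γ * τ) * ‖V τ‖ - 1))]
      have h5 := mul_le_mul_of_nonneg_left h1 p1.le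
      have h6 : γ * f τ ≤ -f' τ / 2 := by
        rw [hγ]
        linarith
      have h7 := mul_le_mul_of_nonneg_left h6 (mul_nonneg hC p1.le)
      simp only [hβ']
      linarith
  have hlim0 : Tendsto (fun k : ℕ => D * Real.exp (-γ * k)) atTop (𝓝 0) := by
    have h1 : Tendsto (fun k : ℕ => γ * (k : ℝ)) atTop atTop :=
      tendsto_natCast_atTop_atTop.const_mul_atTop hγ0
    have h2 := (Real.tendsto_exp_neg_atTop_nhds_zero.comp h1).const_mul D
    simpa [Function.comp_def] using h2
  have hcau : CauchySeq fun k : ℕ => X k := by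
    refine cauchySeq_of_le_tendsto_0' (fun k : ℕ => D * Real.exp (-γ * k)) (fun k l hkl => ?_)
      hlim0
    rw [dist_comm, dist_eq_norm]
    exact key k l (Nat.cast_nonneg k) (Nat.cast_le.2 hkl)
  obtain ⟨N, hN⟩ := cauchySeq_tendsto_of_complete hcau
  refine ⟨N, D, hD0, γ, hγ0, fun t ht => ?_⟩
  have h1 : Tendsto (fun k : ℕ => ‖X t - X k‖) atTop (𝓝 ‖X t - N‖) :=
    (tendsto_const_nhds.sub hN).norm
  refine le_of_tendsto h1 ?_
  filter_upwards [eventually_ge_atTop ⌈t⌉₊] with k hk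
  rw [norm_sub_rev]
  exact key t k ht (Nat.ceil_le.1 hk)

end Convergence

/-! ### Existence and uniqueness of the flow in `M_n[a, b]`. -/

section Existence

open Polynomial Filter Topology Set

variable {n : ℕ} {φ₁ φ₂ : ℝ → ℝ} {K : ℝ}

lemma exists_norm_phi_le (hK : 0 ≤ K) (h₁ : ∀ x y, |φ₁ x - φ₁ y| ≤ K * |x - y|)
    (h₂ : ∀ x y, |φ₂ x - φ₂ y| ≤ K * |x - y|) (R : ℝ) :
    ∃ M, 0 ≤ M ∧ ∀ X : Matrix (Fin n) (Fin n) ℂ, ‖X‖ ≤ R → ‖phi φ₁ φ₂ X‖ ≤ M := by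
  obtain ⟨L, hL0, hL⟩ := exists_norm_phi_sub_le (n := n) hK (S := univ)
    (fun x _ y _ => h₁ x y) (fun x _ y _ => h₂ x y)
  refine ⟨L * |R| + ‖phi φ₁ φ₂ (0 : Matrix (Fin n) (Fin n) ℂ)‖, by positivity, fun X hX => ?_⟩
  have h := hL X 0 (subset_univ _) (subset_univ _) (subset_univ _) (subset_univ _)
  rw [sub_zero] at h
  have h3 := norm_sub_norm_le (phi φ₁ φ₂ X) (phi φ₁ φ₂ 0)
  have h4 := mul_le_mul_of_nonneg_left (hX.trans (le_abs_self R)) hL0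
  linarith

lemma exists_norm_vectorField_sub_le (hK : 0 ≤ K) (h₁ : ∀ x y, |φ₁ x - φ₁ y| ≤ K * |x - y|)
    (h₂ : ∀ x y, |φ₂ x - φ₂ y| ≤ K * |x - y|) (R : ℝ) :
    ∃ L, 0 ≤ L ∧ ∀ X Y : Matrix (Fin n) (Fin n) ℂ, ‖X‖ ≤ R → ‖Y‖ ≤ R →
      ‖⁅phi φ₁ φ₂ X, X⁆ - ⁅phi φ₁ φ₂ Y, Y⁆‖ ≤ L * ‖X - Y‖ := by
  obtain ⟨L, hL0, hL⟩ := exists_norm_phi_sub_le (n := n) hK (S := univ)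
    (fun x _ y _ => h₁ x y) (fun x _ y _ => h₂ x y)
  obtain ⟨M, hM0, hM⟩ := exists_norm_phi_le (n := n) hK h₁ h₂ R
  refine ⟨2 * (L * |R| + M), by positivity, fun X Y hX hY => ?_⟩
  refine (norm_lie_sub_lie_le _ _ _ _).trans ?_
  have h3 := mul_le_mul (hL X Y (subset_univ _) (subset_univ _) (subset_univ _) (subset_univ _))
    (hX.trans (le_abs_self R)) (norm_nonneg _) (by positivity)
  have h4 := mul_le_mul_of_nonneg_right (hM Y hY) (norm_nonneg (X - Y))
  linarith

/-- The flow of the inverse is the flow for the reflected pair of functions. -/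
lemma phi_inverse {X Y : Matrix (Fin n) (Fin n) ℂ} (h : Y * X = 1) :
    phi (fun y => -φ₂ y⁻¹) (fun y => -φ₁ y⁻¹) Y = phi φ₁ φ₂ X := by
  have h' : Yᴴ * Xᴴ = 1 := by
    rw [← Matrix.conjTranspose_mul, mul_eq_one_comm.1 h, Matrix.conjTranspose_one]
  have e1 := cfc_comp_inv_matAbs h (fun x => -φ₂ x)
  have e2 := cfc_comp_inv_matAbs h' (fun x => -φ₁ x)
  rw [Matrix.conjTranspose_conjTranspose] at e2
  rw [phi, phi, e1, e2, cfc_neg φ₁, cfc_neg φ₂]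
  abel

lemma pos_of_mem_spectrum_of_inverse {X Y : Matrix (Fin n) (Fin n) ℂ} (h : Y * X = 1) {x : ℝ}
    (hx : x ∈ spectrum ℝ (matAbs X)) : 0 < x := by
  have h1 := one_le_norm_mul_of_inverse h hx
  have h2 := nonneg_of_mem_spectrum_matAbs hx
  refine h2.lt_of_ne fun h0 => ?_
  rw [← h0, mul_zero] at h1
  linarith

/-- The flow preserves lower bounds of the singular values. -/
lemma norm_inverse_le_of_flow {X Y : ℝ → Matrix (Fin n) (Fin n) ℂ} [Nonempty (Fin n)]
    (h₁ : MonotoneOn φ₁ (Ioi 0)) (h₂ : MonotoneOn φ₂ (Ioi 0))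
    (hXY : ∀ t, 0 ≤ t → Y t * X t = 1)
    (hY : ∀ t, 0 ≤ t → HasDerivWithinAt Y ⁅phi φ₁ φ₂ (X t), Y t⁆ (Ici 0) t) {t : ℝ}
    (ht : 0 ≤ t) : ‖Y t‖ ≤ ‖Y 0‖ := by
  have hanti : ∀ φ : ℝ → ℝ, MonotoneOn φ (Ioi 0) → MonotoneOn (fun y => -φ y⁻¹) (Ioi 0) :=
    fun φ hφ x hx y hy hxy => neg_le_neg (hφ (inv_pos.2 (mem_Ioi.1 hy)) (inv_pos.2 (mem_Ioi.1 hx)) (inv_anti₀ hx hxy))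
  refine norm_le_of_eventually_norm_add_smul_le (T := t)
    (v := fun t => ⁅phi φ₁ φ₂ (X t), Y t⁆)
    (fun s hs => (hY s hs.1).continuousWithinAt.mono Icc_subset_Ici_self)
    (fun s hs => (hY s hs.1).mono (Ici_subset_Ici.2 hs.1)) (fun s hs => ?_) t ⟨ht, le_rfl⟩
  have hYX := hXY s hs.1
  have hXY' := mul_eq_one_comm.1 hYX
  have hXY'' : (X s)ᴴ * (Y s)ᴴ = 1 := by
    rw [← Matrix.conjTranspose_mul, hYX, Matrix.conjTranspose_one]
  rw [← phi_inverse hYX]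
  refine eventually_norm_add_smul_lie_le (S := Ioi 0) (hanti _ h₂) (hanti _ h₁)
    (fun x hx => pos_of_mem_spectrum_of_inverse hXY' hx)
    (fun x hx => pos_of_mem_spectrum_of_inverse hXY'' hx) ?_
  rw [mem_Ioi, norm_pos_iff]
  intro h0
  rw [h0, zero_mul] at hYX
  exact zero_ne_one hYX

variable {a b : ℝ}

lemma CondC1.exists_lipschitz (hφ : CondC1 φ₁ φ₂ a b) (hab : a ≤ b) : ∃ K, 0 ≤ K ∧
    (∀ x y, |clampExtend φ₁ a b x - clampExtend φ₁ a b y| ≤ K * |x - y|) ∧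
    ∀ x y, |clampExtend φ₂ a b x - clampExtend φ₂ a b y| ≤ K * |x - y| := by
  obtain ⟨K₁, hK₁0, hK₁⟩ := exists_abs_clampExtend_sub_le hab hφ.lipschitzOn₁
  obtain ⟨K₂, hK₂0, hK₂⟩ := exists_abs_clampExtend_sub_le hab hφ.lipschitzOn₂
  exact ⟨max K₁ K₂, le_max_of_le_left hK₁0,
    fun x y => (hK₁ x y).trans (mul_le_mul_of_nonneg_right (le_max_left _ _) (abs_nonneg _)),
    fun x y => (hK₂ x y).trans (mul_le_mul_of_nonneg_right (le_max_right _ _) (abs_nonneg _))⟩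

lemma isAnnihilatedOn_of_flow {s : Finset ℂ} {X : ℝ → Matrix (Fin n) (Fin n) ℂ} {R : ℝ}
    (hK : 0 ≤ K) (h₁ : ∀ x y, |φ₁ x - φ₁ y| ≤ K * |x - y|)
    (h₂ : ∀ x y, |φ₂ x - φ₂ y| ≤ K * |x - y|)
    (hX : ∀ t, 0 ≤ t → HasDerivWithinAt X ⁅phi φ₁ φ₂ (X t), X t⁆ (Ici 0) t)
    (hR : ∀ t, 0 ≤ t → ‖X t‖ ≤ R) (hs : IsAnnihilatedOn s (X 0)) {t : ℝ} (ht : 0 ≤ t) :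
    IsAnnihilatedOn s (X t) := by
  obtain ⟨M, -, hM⟩ := exists_norm_phi_le (n := n) hK h₁ h₂ R
  exact fun p hp => aeval_eq_zero_of_flow (Φ := fun t => phi φ₁ φ₂ (X t))
    (fun t ht => hM _ (hR t ht)) hX (hs p hp) ht

variable {T : Matrix (Fin n) (Fin n) ℂ}

theorem exists_isGlobalSolution (ha : 0 ≤ a) (hab : a < b) (hφ : CondC1 φ₁ φ₂ a b)
    (hT : T ∈ matInterval n a b) (hdiag : IsDiagonalizable T) :
    ∃ X, IsGlobalSolution φ₁ φ₂ a b T X := by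
  have hb : 0 ≤ b := ha.trans hab.le
  obtain ⟨K, hK0, hK₁, hK₂⟩ := hφ.exists_lipschitz hab.le
  have hm₁ := monotone_clampExtend hab.le hφ.monotoneOn₁
  have hm₂ := monotone_clampExtend hab.le hφ.monotoneOn₂
  obtain ⟨X, hX0, hXn, hXd⟩ := exists_global_solution
    (V := fun X : Matrix (Fin n) (Fin n) ℂ =>
      ⁅phi (clampExtend φ₁ a b) (clampExtend φ₂ a b) X, X⁆)
    (exists_norm_vectorField_sub_le hK0 hK₁ hK₂)
    (fun X => eventually_norm_add_smul_lie_le (hm₁.monotoneOn univ) (hm₂.monotoneOn univ)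
      (subset_univ _) (subset_univ _) (mem_univ _)) T
  have hTb := norm_le_of_mem_matInterval hb hT
  have hXb : ∀ t, 0 ≤ t → ‖X t‖ ≤ b := fun t ht => (hXn t ht).trans hTb
  obtain ⟨s, hs⟩ := hdiag.exists_isAnnihilatedOn
  have hmem : ∀ t, 0 ≤ t → X t ∈ matInterval n a b := by
    rcases isEmpty_or_nonempty (Fin n) with hn | hn
    · intro t _
      rwa [Subsingleton.elim (X t) T]
    rcases ha.eq_or_lt with rfl | ha
    · exact fun t ht => mem_matInterval_zero (hXb t ht)
    obtain ⟨Y₀, hY₀, hY₀n⟩ := exists_inverse_of_mem_matInterval ha hT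
    -- As `g(T)` is the inverse of `T`, the polynomial `gX - 1` annihilates `T`, hence every `X(t)`.
    -- So `g(X(t))` is the inverse of `X(t)`, and its derivative follows from the polynomial
    -- calculus.
    set g := Lagrange.interpolate s id fun x : ℂ => x⁻¹ with hg
    have hgT : aeval T g = Y₀ := by
      have h1 := hs.mul_generalized_inverse_mul
      have h2 : aeval T g * T = 1 := by
        calc aeval T g * T = Y₀ * (T * aeval T g * T) := by
              rw [mul_assoc T, ← mul_assoc Y₀, hY₀, one_mul]
          _ = 1 := by rw [h1, hY₀]
      calc aeval T g = aeval T g * (T * Y₀) := by rw [mul_eq_one_comm.1 hY₀, mul_one]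
        _ = Y₀ := by rw [← mul_assoc, h2, one_mul]
    have hinv : ∀ t, 0 ≤ t → aeval (X t) g * X t = 1 := by
      intro t ht
      obtain ⟨M, -, hM⟩ := exists_norm_phi_le (n := n) hK0 hK₁ hK₂ b
      have h1 := aeval_eq_zero_of_flow
        (Φ := fun t => phi (clampExtend φ₁ a b) (clampExtend φ₂ a b) (X t))
        (fun t ht => hM _ (hXb t ht)) hXd (p := g * Polynomial.X - 1)
        (by rw [hX0, map_sub, map_mul, aeval_X, map_one, hgT, hY₀, sub_self]) ht
      rwa [map_sub, map_mul, aeval_X, map_one, sub_eq_zero] at h1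
    intro t ht
    refine mem_matInterval_of_inverse ha (hXb t ht) (hinv t ht) ?_
    have h2 := norm_inverse_le_of_flow (Y := fun t => aeval (X t) g) (hm₁.monotoneOn _)
      (hm₂.monotoneOn _) hinv (fun t ht => hasDerivWithinAt_aeval_lie (hXd t ht) g) ht
    refine h2.trans ?_
    simp only [hX0, hgT]
    exact hY₀n
  refine ⟨X, hX0, hmem, fun t ht => ?_⟩
  rw [← phi_clampExtend (hmem t ht) (mem_matInterval_conjTranspose ha hb (hmem t ht))]
  exact hXd t ht

lemma IsGlobalSolution.hasDeriv_clampExtend {X : ℝ → Matrix (Fin n) (Fin n) ℂ} (ha : 0 ≤ a)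
    (hab : a < b) (h : IsGlobalSolution φ₁ φ₂ a b T X) {t : ℝ} (ht : 0 ≤ t) :
    HasDerivWithinAt X ⁅phi (clampExtend φ₁ a b) (clampExtend φ₂ a b) (X t), X t⁆ (Ici 0) t := by
  rw [phi_clampExtend (h.mem t ht)
    (mem_matInterval_conjTranspose ha (ha.trans hab.le) (h.mem t ht))]
  exact h.hasDeriv t ht

theorem IsGlobalSolution.eqOn {X X' : ℝ → Matrix (Fin n) (Fin n) ℂ} (ha : 0 ≤ a) (hab : a < b)
    (hφ : CondC1 φ₁ φ₂ a b) (h : IsGlobalSolution φ₁ φ₂ a b T X)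
    (h' : IsGlobalSolution φ₁ φ₂ a b T X') : EqOn X' X (Ici 0) := by
  intro t ht
  have hb : 0 ≤ b := ha.trans hab.le
  obtain ⟨K, hK0, hK₁, hK₂⟩ := hφ.exists_lipschitz hab.le
  obtain ⟨L, hL0, hL⟩ := exists_norm_vectorField_sub_le (n := n) hK0 hK₁ hK₂ b
  have hball : ∀ {Z : ℝ → Matrix (Fin n) (Fin n) ℂ}, IsGlobalSolution φ₁ φ₂ a b T Z →
      ∀ s ∈ Ico 0 t, Z s ∈ Metric.closedBall 0 b := fun hZ s hs => by
    simpa using norm_le_of_mem_matInterval hb (hZ.mem s hs.1)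
  have hd : ∀ {Z : ℝ → Matrix (Fin n) (Fin n) ℂ}, IsGlobalSolution φ₁ φ₂ a b T Z →
      ∀ s ∈ Ico 0 t, HasDerivWithinAt Z
        ⁅phi (clampExtend φ₁ a b) (clampExtend φ₂ a b) (Z s), Z s⁆ (Ici s) s := fun hZ s hs =>
    (hZ.hasDeriv_clampExtend ha hab hs.1).mono (Ici_subset_Ici.2 hs.1)
  have hc : ∀ {Z : ℝ → Matrix (Fin n) (Fin n) ℂ}, IsGlobalSolution φ₁ φ₂ a b T Z →
      ContinuousOn Z (Icc 0 t) := fun hZ s hs =>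
    (hZ.hasDeriv s hs.1).continuousWithinAt.mono Icc_subset_Ici_self
  refine ODE_solution_unique_of_mem_Icc_right
    (v := fun _ Z => ⁅phi (clampExtend φ₁ a b) (clampExtend φ₂ a b) Z, Z⁆) (K := ⟨L, hL0⟩)
    (s := fun _ => Metric.closedBall 0 b) (fun s _ => ?_) (hc h') (hd h') (hball h') (hc h)
    (hd h) (hball h) (by rw [h.initial, h'.initial]) ⟨ht, le_rfl⟩
  refine LipschitzOnWith.of_dist_le_mul fun x hx y hy => ?_
  rw [dist_eq_norm, dist_eq_norm]
  exact hL x y (by simpa using hx) (by simpa using hy)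

end Existence

/-! ### Uniform dissipation and identification of the limit. -/

section Limit

open Polynomial Filter Topology Set

variable {n : ℕ} {φ₁ φ₂ : ℝ → ℝ} {a b : ℝ} {T : Matrix (Fin n) (Fin n) ℂ}

/-- The dissipation is quadratically nondegenerate when the singular values are `0` or at least
`m`. -/
lemma CondC1.exists_dissipation_bound (ha : 0 ≤ a) (hab : a < b) (hφ : CondC1 φ₁ φ₂ a b) {m : ℝ}
    (hm : 0 < m) : ∃ c, 0 < c ∧ ∀ X : Matrix (Fin n) (Fin n) ℂ,
      X ∈ matInterval n a b → (∀ x ∈ spectrum ℝ (matAbs X), x ≠ 0 → m ≤ x) →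
      (∀ x ∈ spectrum ℝ (matAbs Xᴴ), x ≠ 0 → m ≤ x) →
      c * frobSq (matAbs X - matAbs Xᴴ) ≤
        (phi (clampExtend φ₁ a b) (clampExtend φ₂ a b) X * (Xᴴ * X - X * Xᴴ)).trace.re := by
  have hb : 0 ≤ b := ha.trans hab.le
  obtain ⟨κ, hκ0, hκ⟩ := hφ.exists_mul_sub_le (l := max a (m / 3))
    (lt_max_of_lt_right (by positivity)) (le_max_left _ _)
  set f₁ := clampExtend φ₁ a b
  set f₂ := clampExtend φ₂ a b
  have hc₁ : Continuous f₁ := continuous_clampExtend hab.le hφ.continuousOn₁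
  have hc₂ : Continuous f₂ := continuous_clampExtend hab.le hφ.continuousOn₂
  have hm₁ : Monotone f₁ := monotone_clampExtend hab.le hφ.monotoneOn₁
  have hm₂ : Monotone f₂ := monotone_clampExtend hab.le hφ.monotoneOn₂
  have hκ' : ∀ p q, max a (m / 3) ≤ p → p ≤ q → q ≤ b →
      κ * (q - p) ≤ (f₁ q + f₂ q) - (f₁ p + f₂ p) := fun p q hp hpq hq => by
    have hap := (le_max_left _ _).trans hp
    have hpm : p ∈ Icc a b := ⟨hap, hpq.trans hq⟩
    have hqm : q ∈ Icc a b := ⟨hap.trans hpq, hq⟩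
    have := hκ p q hp hpq hq
    simpa only [f₁, f₂, clampExtend_of_mem hpm, clampExtend_of_mem hqm] using this
  refine ⟨κ * m / 27, by positivity, fun X hX h1 h2 => ?_⟩
  have hX' := mem_matInterval_conjTranspose ha hb hX
  -- This `Θ` turns the scalar expression into the sum of two Bregman divergences, one for each
  -- function; the cases `x < y` and `y < x` exchange the roles of `f₁` and `f₂`.
  refine mul_frobSq_le_dissipation (Θ := fun x => sqPrimitive f₁ x - sqPrimitive f₂ x)
    fun x hx y hy => ?_
  have hx0 := nonneg_of_mem_spectrum_matAbs hx
  have hy0 := nonneg_of_mem_spectrum_matAbs hy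
  rcases lt_trichotomy x y with hxy | rfl | hxy
  · have := bregman_lower_bound hc₁ hc₂ hm₁ hm₂ (κ := κ) hx0 hxy hm.le
      (h2 y hy (hx0.trans_lt hxy).ne') fun p q hp hxp hpq hq =>
        hκ' p q (max_le ((hX hx).1.trans hxp) hp) hpq (hq.trans (hX' hy).2)
    linarith
  · simp
  · have := bregman_lower_bound hc₂ hc₁ hm₂ hm₁ (κ := κ) hy0 hxy hm.le
      (h1 x hx (hy0.trans_lt hxy).ne') fun p q hp hyp hpq hq => by
        have := hκ' p q (max_le ((hX' hy).1.trans hyp) hp) hpq (hq.trans (hX hx).2)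
        linarith
    have e : (y - x) ^ 2 = (x - y) ^ 2 := by ring
    rw [e] at this
    linarith

theorem IsGlobalSolution.exists_limit {X : ℝ → Matrix (Fin n) (Fin n) ℂ} (ha : 0 ≤ a)
    (hab : a < b) (hφ : CondC1 φ₁ φ₂ a b) (hdiag : IsDiagonalizable T)
    (h : IsGlobalSolution φ₁ φ₂ a b T X) :
    ∃ N, IsStarNormal N ∧ N ∈ similarityOrbit T ∧ ConvergesExponentially X N := by
  have hb : 0 < b := ha.trans_lt hab
  obtain ⟨K, hK0, hK₁, hK₂⟩ := hφ.exists_lipschitz hab.le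
  obtain ⟨s, hs⟩ := hdiag.exists_isAnnihilatedOn
  have hXd := fun t ht => h.hasDeriv_clampExtend ha hab (t := t) ht
  have hXb : ∀ t, 0 ≤ t → ‖X t‖ ≤ b := fun t ht => norm_le_of_mem_matInterval hb.le (h.mem t ht)
  have hXs : ∀ t, 0 ≤ t → IsAnnihilatedOn s (X t) := fun t ht =>
    isAnnihilatedOn_of_flow hK0 hK₁ hK₂ hXd hXb (by rwa [h.initial]) ht
  have hXc : ContinuousOn X (Ici 0) := fun t ht => (hXd t ht).continuousWithinAt
  have hXo : ∀ t, 0 ≤ t → X t ∈ similarityOrbit T := fun t ht => by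
    have := mem_similarityOrbit_of_continuousOn hXc hXs ht
    rwa [h.initial] at this
  obtain ⟨M, hM0, hM⟩ := exists_norm_aeval_le (n := n)
    (Lagrange.interpolate s id fun x : ℂ => x⁻¹) b
  have hm : ∀ (Z G : Matrix (Fin n) (Fin n) ℂ), Z * G * Z = Z → ‖G‖ ≤ M →
      ∀ x ∈ spectrum ℝ (matAbs Z), x ≠ 0 → (M + 1)⁻¹ ≤ x := fun Z G hZ hG x hx hx0 => by
    have h1 := one_le_norm_mul_of_generalized_inverse hZ hx hx0
    have h2 := mul_le_mul_of_nonneg_right hG (nonneg_of_mem_spectrum_matAbs hx)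
    rw [inv_le_iff_one_le_mul₀ (by positivity)]
    linarith [nonneg_of_mem_spectrum_matAbs hx]
  obtain ⟨c, hc0, hc⟩ := hφ.exists_dissipation_bound (n := n) ha hab
    (inv_pos.2 (by positivity : 0 < M + 1))
  obtain ⟨C, hC0, hC⟩ := exists_abs_frobSq_sub_le (n := n) s b
  -- This is `∑ |λᵢ|²` over the eigenvalues of `T`. As a trace of a polynomial in `T`, it takes the
  -- same value at every `X t`, by similarity.
  set e := (aeval T (Polynomial.X * Lagrange.interpolate s id star)).trace.re
  set D : ℝ → ℝ := fun t => (phi (clampExtend φ₁ a b) (clampExtend φ₂ a b) (X t) *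
    ((X t)ᴴ * X t - X t * (X t)ᴴ)).trace.re with hD
  set G : ℝ → ℝ := fun t => frobSq (matAbs (X t) - matAbs (X t)ᴴ) with hG
  have hG0 : ∀ t, 0 ≤ G t := fun t => frobSq_nonneg _
  have hGD : ∀ t, 0 ≤ t → c * G t ≤ D t := fun t ht => by
    have hg := (hXs t ht).mul_generalized_inverse_mul
    refine hc _ (h.mem t ht) (hm _ _ hg (hM _ (hXb t ht))) (hm _ _ ?_
      ((Matrix.l2_opNorm_conjTranspose _).trans_le (hM _ (hXb t ht))))
    rw [← Matrix.conjTranspose_mul, ← Matrix.conjTranspose_mul, ← mul_assoc, hg]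
  have hself : ∀ t, 0 ≤ t → frobSq ((X t)ᴴ * X t - X t * (X t)ᴴ) ≤ (2 * b) ^ 2 * G t :=
    fun t ht => frobSq_selfCommutator_le (hXb t ht)
  have hfd : ∀ t, 0 ≤ t → HasDerivWithinAt (fun t => frobSq (X t) - e) (-(2 * D t)) (Ici 0) t :=
    fun t ht => (hasDerivWithinAt_frobSq (hXd t ht)).sub_const _
  have hfm : ∀ t, 0 ≤ t → -e ≤ frobSq (X t) - e := fun t _ => by
    linarith [frobSq_nonneg (X t)]
  have hκ : ∀ t, 0 ≤ t → -(2 * D t) ≤ -(2 * c / (C * (2 * b) ^ 2) * |frobSq (X t) - e|) := by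
    intro t ht
    have h1 := hC (X t) (hXs t ht) (hXb t ht)
    rw [trace_aeval_of_mem_similarityOrbit (hXo t ht)] at h1
    have h2 := h1.trans (mul_le_mul_of_nonneg_left (hself t ht) hC0.le)
    have h3 : 2 * c / (C * (2 * b) ^ 2) * |frobSq (X t) - e| ≤ 2 * (c * G t) := by
      calc _ ≤ 2 * c / (C * (2 * b) ^ 2) * (C * ((2 * b) ^ 2 * G t)) :=
            mul_le_mul_of_nonneg_left h2 (by positivity)
        _ = _ := by field_simp
    linarith [hGD t ht]
  have hV : ∀ t, 0 ≤ t → ‖⁅phi (clampExtend φ₁ a b) (clampExtend φ₂ a b) (X t), X t⁆‖ ^ 2 ≤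
      4 * K ^ 2 * b ^ 2 / (2 * c) * (-(-(2 * D t))) := by
    intro t ht
    have h1 := (norm_sq_le_frobSq _).trans (frobSq_lie_phi_le (X := X t) (S := univ)
      (fun x _ y _ => hK₁ x y) (fun x _ y _ => hK₂ x y) (subset_univ _) (subset_univ _))
    have h2 : ‖X t‖ ^ 2 ≤ b ^ 2 := pow_le_pow_left₀ (norm_nonneg _) (hXb t ht) 2
    calc _ ≤ 4 * K ^ 2 * ‖X t‖ ^ 2 * G t := h1
      _ ≤ 4 * K ^ 2 * b ^ 2 * G t :=
        mul_le_mul_of_nonneg_right (mul_le_mul_of_nonneg_left h2 (by positivity)) (hG0 t)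
      _ = 4 * K ^ 2 * b ^ 2 / c * (c * G t) := by field_simp
      _ ≤ 4 * K ^ 2 * b ^ 2 / c * D t := mul_le_mul_of_nonneg_left (hGD t ht) (by positivity)
      _ = _ := by field_simp
  obtain ⟨N, C', hC', γ, hγ, hN⟩ := exists_exponential_limit (by positivity) (by positivity) hXd hfd
    hκ hfm hV
  have hlim : Tendsto X atTop (𝓝 N) := by
    rw [tendsto_iff_norm_sub_tendsto_zero]
    have h1 : Tendsto (fun t : ℝ => C' * Real.exp (-γ * t)) atTop (𝓝 0) := by
      have h2 := (Real.tendsto_exp_neg_atTop_nhds_zero.comp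
        (tendsto_id.const_mul_atTop hγ)).const_mul C'
      simpa [Function.comp_def] using h2
    refine squeeze_zero' (Eventually.of_forall fun t => norm_nonneg _) ?_ h1
    filter_upwards [eventually_ge_atTop 0] with t ht using hN t ht
  refine ⟨N, ?_, ?_, C', hC', γ, hγ, hN⟩
  · have h1 : Tendsto (fun t => 2 * c / (2 * b) ^ 2 * frobSq ((X t)ᴴ * X t - X t * (X t)ᴴ)) atTop
        (𝓝 (2 * c / (2 * b) ^ 2 * frobSq (Nᴴ * N - N * Nᴴ))) := by
      have h2 : Continuous fun Z : Matrix (Fin n) (Fin n) ℂ => frobSq (Zᴴ * Z - Z * Zᴴ) :=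
        continuous_frobSq.comp (by fun_prop)
      exact ((h2.tendsto N).comp hlim).const_mul _
    -- A nonzero self-commutator in the limit would keep the dissipation bounded below and push the
    -- Lyapunov function to `-∞`.
    have h3 := le_zero_of_tendsto_of_deriv_le hfd (fun t ht => ?_) hfm h1
    · have h4 : frobSq (Nᴴ * N - N * Nᴴ) ≤ 0 := nonpos_of_mul_nonpos_right h3 (by positivity)
      have h5 := frobSq_eq_zero (le_antisymm h4 (frobSq_nonneg _))
      exact ⟨sub_eq_zero.1 h5⟩
    · have h4 : 2 * c / (2 * b) ^ 2 * frobSq ((X t)ᴴ * X t - X t * (X t)ᴴ) ≤ 2 * (c * G t) := by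
        calc _ ≤ 2 * c / (2 * b) ^ 2 * ((2 * b) ^ 2 * G t) :=
              mul_le_mul_of_nonneg_left (hself t ht) (by positivity)
          _ = _ := by field_simp
      linarith [hGD t ht]
  · have hev : ∀ᶠ t in atTop, IsAnnihilatedOn s (X t) := by
      filter_upwards [eventually_ge_atTop 0] with t ht using hXs t ht
    have hNs : IsAnnihilatedOn s N := IsAnnihilatedOn.of_tendsto hlim hev
    obtain ⟨t, ht, h1, h2⟩ := ((hlim.eventually hNs.eventually_mem_similarityOrbit).and
      (hev.and (eventually_ge_atTop 0))).exists
    exact mem_similarityOrbit_trans (hXo t h2) (mem_similarityOrbit_symm (ht h1))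

end Limit

end MatrixFlow

theorem theorem3 (n : ℕ) (a b : ℝ) (ha : 0 ≤ a) (hab : a < b) (φ₁ φ₂ : ℝ → ℝ)
    (hφ : MatrixFlow.CondC1 φ₁ φ₂ a b) (T : Matrix (Fin n) (Fin n) ℂ)
    (hT : T ∈ MatrixFlow.matInterval n a b) (hdiag : MatrixFlow.IsDiagonalizable T) :
    ∃ X : ℝ → Matrix (Fin n) (Fin n) ℂ,
      MatrixFlow.IsGlobalSolution φ₁ φ₂ a b T X ∧
      (∀ X' : ℝ → Matrix (Fin n) (Fin n) ℂ,
        MatrixFlow.IsGlobalSolution φ₁ φ₂ a b T X' → Set.EqOn X' X (Set.Ici 0)) ∧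
      ∃ N : Matrix (Fin n) (Fin n) ℂ,
        IsStarNormal N ∧ N ∈ MatrixFlow.similarityOrbit T ∧
        MatrixFlow.ConvergesExponentially X N := by
  obtain ⟨X, hX⟩ := MatrixFlow.exists_isGlobalSolution ha hab hφ hT hdiag
  exact ⟨X, hX, fun X' hX' => hX.eqOn ha hab hφ hX', hX.exists_limit ha hab hφ hdiag⟩
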